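/- Let $\Omega\subset\mathbb{R}^d$ be a bounded open set and let $\mathcal{T}_h=\{K_1,\dots,K_N\}$ be a finite partition of $\Omega$ into convex polytopes: closed convex polytopes with pairwise disjoint nonempty interiors contained in $\Omega$ and with $\bigcup_j K_j=\overline\Omega$ (hanging nodes are allowed). An interior face is a set $e=\partial K\cap\partial K'\cap\Omega$ of positive $(d-1)$-dimensional measure, $K$ being the element with the smaller label, and $n_e$ is the unit normal pointing out of $K$; a boundary face is the part in $\partial\Omega$ of a facet of an element, if that part has positive $(d-1)$-dimensional measure, and $n_e$ is the unit normal pointing out of that element. Let $\mathcal{E}_h^I$ and $\mathcal{E}_h^B$ be the sets of interior and boundary faces and $\mathcal{E}_h=\mathcal{E}_h^I\cup\mathcal{E}_h^B$. Let $r\ge 0$ be an integer, let $V^h_r=\prod_{K\in\mathcal{T}_h}\mathbb{P}_r(K)\subset L^2(\Omega)$ be the space of piecewise polynomials of total degree at most $r$, let $\mathcal{P}^h_r:L^2(\Omega)\to V^h_r$ be the $L^2$ projection, and let $\mathcal{V}_h=\prod_K W^{1,1}(K)\cap\prod_K C^0(\overline K)$. Write $(v,w)_{\mathcal{T}_h}=\sum_K\int_K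 vw\,dx$ and $\langle v,w\rangle_{\mathcal{S}}=\sum_{e\in\mathcal{S}}\int_e vw\,ds$ for $\mathcal{S}\subset\mathcal{E}_h$. On an interior face set $[v]=v|_K-v|_{K'}$; on a boundary face set $[v]=v$. Fix $i\in\{1,\dots,d\}$ and real numbers $\gamma^-_{i,e},\gamma^+_{i,e}$ for $e\in\mathcal{E}_h^I$, and regard $\gamma_i^\pm$ as piecewise constant functions on the interior faces. For $v\in\mathcal{V}_h$ define on an interior face $$\mathcal{Q}_i^-(v)=\begin{cases}v|_K&\text{if }n_e^{(i)}<0,\\ v|_{K'}&\text{if }n_e^{(i)}\ge 0,\end{cases}\qquad \mathcal{Q}_i^+(v)=\begin{cases}v|_{K'}&\text{if }n_e^{(i)}<0,\\ v|_K&\text{if }n_e^{(i)}\ge 0,\end{cases}$$ where $v|_K,v|_{K'}$ are the limits from inside $K$ and $K'$, and let $\mathcal{Q}_i^\pm(v)$ be the trace of $v$ on a boundary face. The discrete derivatives $\partial^\pm_{h,x_i}v\in V^h_r$ are defined by $$(\partial^\pm_{h,x_i}v,\varphi_h)_{\mathcal{T}_h}=\langle \mathcal{Q}_i^\pm(v)\,n^{(i)},[\varphi_h]\rangle_{\mathcal{E}_h}-(v,\partial_{x_i}\varphi_h)_{\mathcal{T}_h}+\langle\gamma_i^\pm[v],[\varphi_h]\rangle_{\mathcal{E}_h^I}\qquad\text{for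 all }\varphi_h\in V^h_r,$$ where $n^{(i)}|_e=n_e^{(i)}$ and $\partial_{x_i}\varphi_h$ is taken element by element, and $\partial_{h,x_i}v=\frac12(\partial^-_{h,x_i}v+\partial^+_{h,x_i}v)$. Then for every $v\in\mathcal{V}_h\cap H^1(\Omega)$ the functions $\partial^\pm_{h,x_i}v\in V^h_r$ exist and are uniquely determined by their defining identities, and $$\partial^-_{h,x_i}v=\partial^+_{h,x_i}v=\partial_{h,x_i}v=\mathcal{P}^h_r(\partial_{x_i}v),$$ where $\partial_{x_i}v\in L^2(\Omega)$ is the weak derivative. -/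

import Mathlib

open MeasureTheory Set Topology
open scoped ContDiff ENNReal

noncomputable section

namespace DGCalculus

/-- `ℝᵈ` with its Euclidean structure. -/
abbrev E (d : ℕ) : Type := EuclideanSpace ℝ (Fin d)

/-! ### Weak derivatives and Sobolev spaces -/

/-- `g` is the weak partial derivative `∂_{x_i} v` on the open set `U`. -/
def IsWeakPartial {d : ℕ} (U : Set (E d)) (i : Fin d) (v g : E d → ℝ) : Prop :=
  LocallyIntegrableOn v U ∧ LocallyIntegrableOn g U ∧
    ∀ φ : E d → ℝ, ContDiff ℝ ∞ φ → HasCompactSupport φ → tsupport φ ⊆ U →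
      ∫ x in U, v x * fderiv ℝ φ x (EuclideanSpace.single i 1) = - ∫ x in U, g x * φ x

/-- `v ∈ W^{1,p}(U)` for the open set `U`; `H¹(U)` is the case `p = 2`. -/
def MemW1 {d : ℕ} (U : Set (E d)) (p : ℝ≥0∞) (v : E d → ℝ) : Prop :=
  MemLp v p (volume.restrict U) ∧
    ∀ i : Fin d, ∃ g : E d → ℝ, MemLp g p (volume.restrict U) ∧ IsWeakPartial U i v g

/-! ### Meshes -/

/-- A convex polytope with nonempty interior in `ℝᵈ`, given by finitely many half-spaces
`{x | ⟪n, x⟫ ≤ c}`, each recorded as the pair `(n, c)` of its outward unit normal and its offset. -/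
structure Polytope (d : ℕ) where
  halfspaces : Finset (E d × ℝ)
  norm_normal : ∀ h ∈ halfspaces, ‖h.1‖ = 1
  isBounded : Bornology.IsBounded {x : E d | ∀ h ∈ halfspaces, inner ℝ h.1 x ≤ h.2}
  interior_nonempty : (interior {x : E d | ∀ h ∈ halfspaces, inner ℝ h.1 x ≤ h.2}).Nonempty

namespace Polytope

variable {d : ℕ}

/-- The closed point set of the polytope. -/
def carrier (K : Polytope d) : Set (E d) := {x | ∀ h ∈ K.halfspaces, inner ℝ h.1 x ≤ h.2}

/-- The part of the polytope on the bounding hyperplane of one of its half-spaces. -/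
def facet (K : Polytope d) (h : K.halfspaces) : Set (E d) :=
  {x ∈ K.carrier | inner ℝ h.1.1 x = h.1.2}

/-- The trace at `x ∈ K` of `v`, from within `K`: the limit of `v y` as `y → x`, `y ∈ interior K`. -/
def trace (K : Polytope d) (v : E d → ℝ) (x : E d) : ℝ :=
  Filter.limUnder (𝓝[interior K.carrier] x) v

theorem isCompact_carrier (K : Polytope d) : IsCompact K.carrier := by
  refine Metric.isCompact_of_isClosed_isBounded ?_ K.isBounded
  have : K.carrier = ⋂ h ∈ K.halfspaces, {x : E d | inner ℝ h.1 x ≤ h.2} := by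
    ext x; simp [carrier]
  rw [this]
  exact isClosed_biInter fun h _ => isClosed_le (by fun_prop) continuous_const

end Polytope

/-- A partition of the open set `Ω` into finitely many convex polytopes; the index of an
element is its global labelling number. Hanging nodes are allowed. -/
structure Mesh {d : ℕ} (Ω : Set (E d)) where
  numCells : ℕ
  cell : Fin numCells → Polytope d
  interior_subset : ∀ j, interior (cell j).carrier ⊆ Ω
  iUnion_eq : ⋃ j, (cell j).carrier = closure Ω
  disjoint : ∀ j k, j ≠ k → Disjoint (interior (cell j).carrier) (interior (cell k).carrier)

/-- `∏_K ℙ_r(K)`: one polynomial of total degree at most `r` for each of `N` elements. -/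
abbrev DGSpace (d N r : ℕ) : Type := Fin N → MvPolynomial.restrictTotalDegree (Fin d) ℝ r

/-- The value at `x` of a polynomial in `d` variables. -/
def polyEval {d : ℕ} (p : MvPolynomial (Fin d) ℝ) (x : E d) : ℝ :=
  MvPolynomial.eval (fun i => x i) p

theorem continuous_polyEval {d : ℕ} (p : MvPolynomial (Fin d) ℝ) : Continuous (polyEval p) := by
  unfold polyEval
  have h : Continuous fun x : E d => (fun i => x i : Fin d → ℝ) := by fun_prop
  exact (MvPolynomial.continuous_eval p).comp h

namespace Mesh

variable {d : ℕ} {Ω : Set (E d)} (T : Mesh Ω)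

/-! ### Faces -/

/-- Point set of the candidate interior face between the elements `a.1.1` and `a.2`, on the
facet `a.1.2` of the former. -/
def interiorFaceSet (a : (Σ j : Fin T.numCells, (T.cell j).halfspaces) × Fin T.numCells) :
    Set (E d) :=
  (T.cell a.1.1).facet a.1.2 ∩ (T.cell a.2).carrier ∩ Ω

/-- The interior faces `e = ∂K ∩ ∂K'`: a face is recorded by the element `K` of smaller label, the
bounding hyperplane of `K` that contains it, and the element `K'` of larger label; it has
positive `(d-1)`-dimensional measure. -/
def InteriorFace : Type :=
  {a : (Σ j : Fin T.numCells, (T.cell j).halfspaces) × Fin T.numCells //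
    a.1.1 < a.2 ∧ Measure.euclideanHausdorffMeasure (d - 1) (T.interiorFaceSet a) ≠ 0}

/-- Point set of the candidate boundary face on the facet `b.2` of the element `b.1`. -/
def boundaryFaceSet (b : Σ j : Fin T.numCells, (T.cell j).halfspaces) : Set (E d) :=
  (T.cell b.1).facet b.2 ∩ frontier Ω

/-- The boundary faces: the parts of `∂Ω` of positive `(d-1)`-dimensional measure on the facets
of the elements. -/
def BoundaryFace : Type :=
  {b : Σ j : Fin T.numCells, (T.cell j).halfspaces //
    Measure.euclideanHausdorffMeasure (d - 1) (T.boundaryFaceSet b) ≠ 0}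

instance : Finite T.InteriorFace := by unfold InteriorFace; infer_instance

instance : Finite T.BoundaryFace := by unfold BoundaryFace; infer_instance

instance : Fintype T.InteriorFace := Fintype.ofFinite _

instance : Fintype T.BoundaryFace := Fintype.ofFinite _

variable {T}

namespace InteriorFace

/-- The label of the element `K` (the smaller one). -/
def left (e : T.InteriorFace) : Fin T.numCells := e.1.1.1

/-- The label of the element `K'` (the larger one). -/
def right (e : T.InteriorFace) : Fin T.numCells := e.1.2

/-- The unit normal `n_e = n_K|_e`. -/
def normal (e : T.InteriorFace) : E d := e.1.1.2.1.1

/-- `∫_e f ds`. -/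
def integral (e : T.InteriorFace) (f : E d → ℝ) : ℝ :=
  ∫ x in T.interiorFaceSet e.1, f x ∂(Measure.euclideanHausdorffMeasure (d - 1))

/-- The trace `v|_K` on `e`. -/
def traceLeft (e : T.InteriorFace) (v : E d → ℝ) (x : E d) : ℝ := (T.cell e.left).trace v x

/-- The trace `v|_{K'}` on `e`. -/
def traceRight (e : T.InteriorFace) (v : E d → ℝ) (x : E d) : ℝ := (T.cell e.right).trace v x

/-- The jump `[v] = v|_K - v|_{K'}`. -/
def jump (e : T.InteriorFace) (v : E d → ℝ) (x : E d) : ℝ := e.traceLeft v x - e.traceRight v x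

/-- The jump `[φ]` of a piecewise polynomial. -/
def polyJump {r : ℕ} (e : T.InteriorFace) (φ : DGSpace d T.numCells r) (x : E d) : ℝ :=
  polyEval (φ e.left).1 x - polyEval (φ e.right).1 x

open Classical in
/-- The trace operator `𝒬_i^-` on an interior face. -/
def Qminus (i : Fin d) (e : T.InteriorFace) (v : E d → ℝ) (x : E d) : ℝ :=
  if e.normal i < 0 then e.traceLeft v x else e.traceRight v x

open Classical in
/-- The trace operator `𝒬_i^+` on an interior face. -/
def Qplus (i : Fin d) (e : T.InteriorFace) (v : E d → ℝ) (x : E d) : ℝ :=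
  if e.normal i < 0 then e.traceRight v x else e.traceLeft v x

end InteriorFace

namespace BoundaryFace

/-- The label of the element that the boundary face belongs to. -/
def owner (e : T.BoundaryFace) : Fin T.numCells := e.1.1

/-- The unit normal `n_e`, pointing out of the owning element. -/
def normal (e : T.BoundaryFace) : E d := e.1.2.1.1

/-- `∫_e f ds`. -/
def integral (e : T.BoundaryFace) (f : E d → ℝ) : ℝ :=
  ∫ x in T.boundaryFaceSet e.1, f x ∂(Measure.euclideanHausdorffMeasure (d - 1))

end BoundaryFace

variable (T)

/-! ### Function spaces on the mesh -/

/-- `v ∈ 𝒱_h = W^{1,1}(𝒯_h) ∩ C⁰(𝒯_h)`: on each element `v` is of class `W^{1,1}` and extends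
continuously to the closed element. -/
def MemBroken (v : E d → ℝ) : Prop :=
  ∀ j, MemW1 (interior (T.cell j).carrier) 1 v ∧
    ∃ f : E d → ℝ, ContinuousOn f (T.cell j).carrier ∧ EqOn v f (interior (T.cell j).carrier)

/-- A piecewise polynomial as a function on `ℝᵈ` (zero outside the open elements). -/
def toFun {r : ℕ} (φ : DGSpace d T.numCells r) (x : E d) : ℝ :=
  ∑ j, (interior (T.cell j).carrier).indicator (polyEval (φ j).1) x

theorem memLp_toFun {r : ℕ} (φ : DGSpace d T.numCells r) :
    MemLp (T.toFun φ) 2 (volume.restrict Ω) := by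
  unfold toFun
  refine memLp_finsetSum _ fun j _ => ?_
  rw [memLp_indicator_iff_restrict isOpen_interior.measurableSet]
  have hK := (T.cell j).isCompact_carrier
  have hc := continuous_polyEval (φ j).1
  obtain ⟨C, hC⟩ := hK.exists_bound_of_continuousOn hc.continuousOn
  have hfin : IsFiniteMeasure
      ((volume.restrict Ω).restrict (interior (T.cell j).carrier)) := by
    refine ⟨?_⟩
    rw [Measure.restrict_apply_univ]
    exact (Measure.restrict_apply_le _ _).trans_lt
      ((measure_mono _root_.interior_subset).trans_lt hK.measure_lt_top)
  refine MemLp.of_bound hc.aestronglyMeasurable C ?_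
  refine (ae_restrict_iff' isOpen_interior.measurableSet).2 (Filter.Eventually.of_forall ?_)
  intro x hx
  exact hC x (_root_.interior_subset hx)

/-- The embedding of `V_r^h` into `L²(Ω)`. -/
def toL2 (r : ℕ) : DGSpace d T.numCells r →ₗ[ℝ] Lp ℝ 2 (volume.restrict Ω) where
  toFun φ := (T.memLp_toFun φ).toLp _
  map_add' φ ψ := by
    rw [← MemLp.toLp_add]
    congr 1
    ext x
    simp only [Mesh.toFun, Pi.add_apply, Submodule.coe_add, ← Finset.sum_add_distrib]
    refine Finset.sum_congr rfl fun j _ => ?_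
    by_cases hx : x ∈ interior (T.cell j).carrier <;> simp [hx, polyEval]
  map_smul' c φ := by
    rw [RingHom.id_apply, ← MemLp.toLp_const_smul]
    congr 1
    ext x
    simp only [Mesh.toFun, Pi.smul_apply, Submodule.coe_smul, smul_eq_mul, Finset.mul_sum]
    refine Finset.sum_congr rfl fun j _ => ?_
    by_cases hx : x ∈ interior (T.cell j).carrier <;> simp [hx, polyEval, MvPolynomial.smul_eval]

/-- `V_r^h` as a (finite-dimensional) subspace of `L²(Ω)`. -/
def dgSubspace (r : ℕ) : Submodule ℝ (Lp ℝ 2 (volume.restrict Ω)) := LinearMap.range (T.toL2 r)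

instance (r : ℕ) : FiniteDimensional ℝ (T.dgSubspace r) := by unfold dgSubspace; infer_instance

/-- The `L²` projection `𝒫_r^h : L²(Ω) → V_r^h`. -/
def projection (r : ℕ) : Lp ℝ 2 (volume.restrict Ω) →L[ℝ] Lp ℝ 2 (volume.restrict Ω) :=
  (T.dgSubspace r).starProjection

/-! ### Discrete partial derivatives -/

/-- The inner product `(w, φ)_{𝒯_h}` on `V_r^h`. -/
def innerProd {r : ℕ} (w φ : DGSpace d T.numCells r) : ℝ :=
  ∑ j, ∫ x in (T.cell j).carrier, polyEval (w j).1 x * polyEval (φ j).1 x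

/-- The right-hand side
`⟨𝒬(v) n^{(i)}, [φ]⟩_{ℰ_h} - (v, ∂_{x_i} φ)_{𝒯_h} + ⟨γ [v], [φ]⟩_{ℰ_h^I}`
of the definition of the discrete derivatives, where `Q` is a trace operator on the interior faces;
on a boundary face the trace operator is the trace of `v`, and `[φ] = φ`. -/
def derivForm {r : ℕ} (i : Fin d) (Q : T.InteriorFace → (E d → ℝ) → E d → ℝ)
    (γ : T.InteriorFace → ℝ) (v : E d → ℝ) (φ : DGSpace d T.numCells r) : ℝ :=
  (∑ e : T.InteriorFace, e.integral fun x => Q e v x * e.normal i * e.polyJump φ x)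
    + (∑ e : T.BoundaryFace, e.integral fun x =>
        (T.cell e.owner).trace v x * e.normal i * polyEval (φ e.owner).1 x)
    - (∑ j, ∫ x in (T.cell j).carrier, v x * polyEval (MvPolynomial.pderiv i (φ j).1) x)
    + ∑ e : T.InteriorFace, e.integral fun x => γ e * e.jump v x * e.polyJump φ x

/-- `w = ∂_{h,x_i}^- v`, with penalty parameters `γ = γ_i^-`. -/
def IsPartialMinus {r : ℕ} (i : Fin d) (γ : T.InteriorFace → ℝ) (v : E d → ℝ)
    (w : DGSpace d T.numCells r) : Prop :=
  ∀ φ : DGSpace d T.numCells r, T.innerProd w φ = T.derivForm i (InteriorFace.Qminus i) γ v φ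

/-- `w = ∂_{h,x_i}^+ v`, with penalty parameters `γ = γ_i^+`. -/
def IsPartialPlus {r : ℕ} (i : Fin d) (γ : T.InteriorFace → ℝ) (v : E d → ℝ)
    (w : DGSpace d T.numCells r) : Prop :=
  ∀ φ : DGSpace d T.numCells r, T.innerProd w φ = T.derivForm i (InteriorFace.Qplus i) γ v φ

/-- `∂_{h,x_i}^- v ∈ V_r^h`, the element singled out by `IsPartialMinus`. -/
def partialMinus (r : ℕ) (i : Fin d) (γ : T.InteriorFace → ℝ) (v : E d → ℝ) :
    DGSpace d T.numCells r :=
  Classical.epsilon (T.IsPartialMinus i γ v)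

/-- `∂_{h,x_i}^+ v ∈ V_r^h`, the element singled out by `IsPartialPlus`. -/
def partialPlus (r : ℕ) (i : Fin d) (γ : T.InteriorFace → ℝ) (v : E d → ℝ) :
    DGSpace d T.numCells r :=
  Classical.epsilon (T.IsPartialPlus i γ v)

/-- `∂_{h,x_i} v = ½ (∂_{h,x_i}^- v + ∂_{h,x_i}^+ v)`. -/
def partialCentral (r : ℕ) (i : Fin d) (γm γp : T.InteriorFace → ℝ) (v : E d → ℝ) :
    DGSpace d T.numCells r :=
  (1 / 2 : ℝ) • (T.partialMinus r i γm v + T.partialPlus r i γp v)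

end Mesh

end DGCalculus

end

/-!
For `v ∈ H¹(Ω)` the right-hand side of the definition of the discrete derivatives does not depend on
the choice of one-sided traces or penalties: it is `(∂ᵢ v, φ)` for every `φ ∈ V_r^h`. So the
discrete derivatives are the Riesz representatives in `V_r^h` of the `L²` pairing with `∂ᵢ v`, that
is, they are the `L²` projection of `∂ᵢ v` (`Mesh.existsUnique_innerProd_eq`, with uniqueness from
the injectivity of `V_r^h → L²(Ω)`).

Three facts give the identity `Mesh.derivForm_eq`.

* The Gauss-Green formula `Polytope.integral_weakPartial_mul_add` on a convex polytope, for a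
  function that is continuous up to the boundary and has an integrable weak derivative. The weak
  derivative is tested with `χ_k ψ`, where the cutoff function `χ_k` is the product over the
  half-spaces of `ramp (k * (c - ⟪n, x⟫))`. The derivative of `χ_k` is a sum of densities, one for
  each facet, concentrated in a layer of width `1 / k` at that facet; slicing the layer by parallel
  hyperplanes shows that they converge to `-nᵢ` times the surface measure of the facet
  (`Polytope.tendsto_integral_layer`). Only continuity of the function is needed for this limit.
* The geometry of the mesh. Elements that share a part of a facet of positive measure have opposite
  half-spaces there (`Polytope.neg_mem_halfspaces`, by separation of their interiors), so that three
  elements meet a facet only in a null set. Hence the sum of the surface integrals over the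
  boundaries of all elements is a sum of jumps over the interior faces plus the boundary terms
  (`Mesh.sum_facet_integral`).
* The absence of jumps (`Mesh.jump_ae_eq_zero`). For test functions on `Ω`, the first two facts
  say that the jumps of `v`, times `nᵢ` and the surface measure of the interior faces, form the zero
  distribution; since every face has a direction `i` with `nᵢ ≠ 0`, its jump vanishes almost
  everywhere.
-/

noncomputable section

namespace DGCalculus

variable {d : ℕ}

/-! ### Measures on hyperplanes -/

/-- Orthogonal coordinates `x = t n + y` with `y ∈ nᗮ` preserve volume. -/
theorem measurePreserving_smul_add {n : E d} (hn : ‖n‖ = 1) :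
    MeasurePreserving (fun p : ℝ × (ℝ ∙ n)ᗮ => p.1 • n + (p.2 : E d))
      (volume.prod volume) volume := by
  have h1 := ((ℝ ∙ n).measurePreserving_measurableEquivProd (0 : E d)).symm
  rw [InnerProductSpace.euclideanHausdorffMeasure_eq_volume] at h1
  have h2 := ((LinearIsometryEquiv.toSpanUnitSingleton n hn).measurePreserving).prod
    (MeasurePreserving.id (volume : Measure (ℝ ∙ n)ᗮ))
  have h3 := h1.comp h2
  convert! h3 using 1
  ext p
  simp

theorem inner_smul_add {n : E d} (hn : ‖n‖ = 1) (t : ℝ) (y : (ℝ ∙ n)ᗮ) :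
    inner ℝ n (t • n + (y : E d)) = t := by
  have : inner ℝ n (y : E d) = 0 := Submodule.mem_orthogonal_singleton_iff_inner_right.1 y.2
  rw [inner_add_right, this, inner_smul_right, real_inner_self_eq_norm_sq, hn]; simp

theorem isometry_smul_add (n : E d) (c : ℝ) :
    Isometry (fun y : (ℝ ∙ n)ᗮ => c • n + (y : E d)) :=
  (IsometryEquiv.addLeft (c • n)).isometry.comp isometry_subtype_coe

theorem range_smul_add {n : E d} (hn : ‖n‖ = 1) (c : ℝ) :
    range (fun y : (ℝ ∙ n)ᗮ => c • n + (y : E d)) = {x | inner ℝ n x = c} := by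
  ext x
  constructor
  · rintro ⟨y, rfl⟩
    exact inner_smul_add hn c y
  · intro hx
    refine ⟨⟨x - c • n, ?_⟩, by simp⟩
    rw [Submodule.mem_orthogonal_singleton_iff_inner_right, inner_sub_right, hx, inner_smul_right,
      real_inner_self_eq_norm_sq, hn]
    simp

/-- The `(d-1)`-dimensional measure on the hyperplane `⟪n, x⟫ = c` is the volume of `nᗮ`,
transported by `y ↦ c n + y`. -/
theorem map_smul_add {n : E d} (hn : ‖n‖ = 1) (c : ℝ) :
    Measure.map (fun y : (ℝ ∙ n)ᗮ => c • n + (y : E d)) volume =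
      (Measure.euclideanHausdorffMeasure (d - 1)).restrict {x | inner ℝ n x = c} := by
  have hd : Module.finrank ℝ (ℝ ∙ n)ᗮ = d - 1 := by
    have h0 : n ≠ 0 := by rintro rfl; simp at hn
    have h1 := (ℝ ∙ n).finrank_add_finrank_orthogonal
    rw [finrank_span_singleton h0, finrank_euclideanSpace, Fintype.card_fin] at h1
    omega
  rw [← range_smul_add hn, ← (isometry_smul_add n c).map_euclideanHausdorffMeasure, ← hd,
    InnerProductSpace.euclideanHausdorffMeasure_eq_volume]

/-- Integration over a subset of a hyperplane, in the coordinates `y ↦ c n + y` on `nᗮ`. -/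
theorem setIntegral_hyperplane {n : E d} (hn : ‖n‖ = 1) (c : ℝ) {s : Set (E d)}
    (hs : MeasurableSet s) (hsc : s ⊆ {x | inner ℝ n x = c}) (f : E d → ℝ) :
    ∫ x in s, f x ∂(Measure.euclideanHausdorffMeasure (d - 1)) =
      ∫ y : (ℝ ∙ n)ᗮ, s.indicator f (c • n + (y : E d)) := by
  have h1 : Measure.restrict (Measure.euclideanHausdorffMeasure (d - 1)) s =
      ((Measure.euclideanHausdorffMeasure (d - 1)).restrict
        {x : E d | inner ℝ n x = c}).restrict s := by
    rw [Measure.restrict_restrict hs, inter_eq_left.2 hsc]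
  rw [h1, ← integral_indicator hs, ← map_smul_add hn,
    (isometry_smul_add n c).isClosedEmbedding.measurableEmbedding.integral_map]

theorem measure_lt_top_of_subset_hyperplane {n : E d} (hn : ‖n‖ = 1) (c : ℝ) {s : Set (E d)}
    (hb : Bornology.IsBounded s) (hsc : s ⊆ {x | inner ℝ n x = c}) :
    Measure.euclideanHausdorffMeasure (d - 1) s < ⊤ := by
  have h1 := (isometry_smul_add n c).euclideanHausdorffMeasure_preimage (d := d - 1) s
  rw [range_smul_add hn, inter_eq_left.2 hsc] at h1
  rw [← inter_eq_left.2 hsc]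
  refine (Measure.le_restrict_apply _ _).trans_lt ?_
  rw [← map_smul_add hn, (isometry_smul_add n c).isClosedEmbedding.measurableEmbedding.map_apply]
  exact ((isometry_smul_add n c).antilipschitz.isBounded_preimage hb).measure_lt_top

theorem volume_level_set_eq_zero {V : Type*} [NormedAddCommGroup V] [InnerProductSpace ℝ V]
    [FiniteDimensional ℝ V] [MeasurableSpace V] [BorelSpace V] {ℓ : V →ₗ[ℝ] ℝ} (hℓ : ℓ ≠ 0)
    (u : ℝ) : volume {y : V | ℓ y = u} = 0 := by
  rcases eq_empty_or_nonempty {y : V | ℓ y = u} with h | ⟨y₀, hy₀⟩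
  · simp [h]
  have h1 : {y : V | ℓ y = u} = (fun y => y + -y₀) ⁻¹' (LinearMap.ker ℓ : Set V) := by
    ext y
    simp only [mem_ofPred_eq] at hy₀
    simp [hy₀, add_neg_eq_zero]
  rw [h1, measure_preimage_add_right]
  exact Measure.addHaar_submodule _ _ (by rwa [Ne, LinearMap.ker_eq_top])

theorem ae_inner_smul_add_ne {n m : E d} (hn : ‖n‖ = 1) {c u : ℝ}
    (h : ¬ ∃ t : ℝ, m = t • n ∧ u = t * c) :
    ∀ᵐ y : (ℝ ∙ n)ᗮ, inner ℝ m (c • n + (y : E d)) ≠ u := by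
  let ℓ : (ℝ ∙ n)ᗮ →ₗ[ℝ] ℝ := (innerₛₗ ℝ m).comp ((ℝ ∙ n)ᗮ).subtype
  by_cases hℓ : ℓ = 0
  · have hm : m ∈ (ℝ ∙ n)ᗮᗮ := by
      rw [Submodule.mem_orthogonal']
      intro y hy
      exact congrArg (fun f : (ℝ ∙ n)ᗮ →ₗ[ℝ] ℝ => f ⟨y, hy⟩) hℓ
    rw [Submodule.orthogonal_orthogonal, Submodule.mem_span_singleton] at hm
    obtain ⟨t, rfl⟩ := hm
    refine Filter.Eventually.of_forall fun y hy => h ⟨t, rfl, ?_⟩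
    rw [← hy, real_inner_smul_left, inner_smul_add hn]
  · have h2 := volume_level_set_eq_zero hℓ (u - c * inner ℝ m n)
    rw [ae_iff]
    convert! h2 using 2
    ext y
    simp only [ne_eq, not_not, mem_ofPred_eq, inner_add_right, inner_smul_right, ℓ,
      LinearMap.comp_apply, Submodule.subtype_apply, innerₛₗ_apply_apply]
    constructor <;> intro h <;> linarith

/-- Two hyperplanes either coincide or meet in a set of `(d-1)`-dimensional measure zero. -/
theorem hyperplane_inter_null {n m : E d} (hn : ‖n‖ = 1) {c u : ℝ}
    (h : ¬ ∃ t : ℝ, m = t • n ∧ u = t * c) :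
    Measure.euclideanHausdorffMeasure (d - 1)
      ({x : E d | inner ℝ n x = c} ∩ {x | inner ℝ m x = u}) = 0 := by
  rw [inter_comm]
  have hms : MeasurableSet {x : E d | inner ℝ m x = u} :=
    (isClosed_eq (by fun_prop) continuous_const).measurableSet
  rw [← Measure.restrict_apply hms, ← map_smul_add hn,
    Measure.map_apply (isometry_smul_add n c).continuous.measurable hms]
  have := ae_inner_smul_add_ne hn h
  rw [ae_iff] at this
  simpa using this

/-! ### Smooth cutoff functions on polytopes -/

/-- A smooth step, equal to `0` on `(-∞, 1]` and to `1` on `[2, ∞)`. Vanishing up to `1`, and not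
only up to `0`, keeps the support of the cutoff functions away from the boundary. -/
def ramp (t : ℝ) : ℝ := Real.smoothTransition (t - 1)

theorem contDiff_ramp : ContDiff ℝ ∞ ramp :=
  Real.smoothTransition.contDiff.comp (contDiff_id.sub contDiff_const)

theorem ramp_nonneg (t : ℝ) : 0 ≤ ramp t := Real.smoothTransition.nonneg _

theorem ramp_le_one (t : ℝ) : ramp t ≤ 1 := Real.smoothTransition.le_one _

theorem ramp_of_le {t : ℝ} (h : t ≤ 1) : ramp t = 0 :=
  Real.smoothTransition.zero_of_nonpos (by linarith)

theorem ramp_of_ge {t : ℝ} (h : 2 ≤ t) : ramp t = 1 :=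
  Real.smoothTransition.one_of_one_le (by linarith)

theorem continuous_deriv_ramp : Continuous (deriv ramp) :=
  contDiff_ramp.continuous_deriv (by simp)

theorem deriv_ramp_of_notMem {t : ℝ} (h : t ∉ Icc (1 : ℝ) 2) : deriv ramp t = 0 := by
  rw [mem_Icc, not_and_or, not_le, not_le] at h
  rcases h with h | h
  · have : ramp =ᶠ[𝓝 t] fun _ => 0 := by
      filter_upwards [Iio_mem_nhds h] with s hs using ramp_of_le (le_of_lt hs)
    rw [this.deriv_eq]; simp
  · have : ramp =ᶠ[𝓝 t] fun _ => 1 := by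
      filter_upwards [Ioi_mem_nhds h] with s hs using ramp_of_ge (le_of_lt hs)
    rw [this.deriv_eq]; simp

theorem hasCompactSupport_deriv_ramp : HasCompactSupport (deriv ramp) :=
  HasCompactSupport.intro isCompact_Icc fun _ h => deriv_ramp_of_notMem h

theorem integral_deriv_ramp : ∫ t, deriv ramp t = 1 := by
  have h1 : ∫ t, deriv ramp t = ∫ t in Icc (1 : ℝ) 2, deriv ramp t :=
    (setIntegral_eq_integral_of_forall_compl_eq_zero fun t h => deriv_ramp_of_notMem h).symm
  rw [h1, integral_Icc_eq_integral_Ioc, ← intervalIntegral.integral_of_le (by norm_num),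
    intervalIntegral.integral_deriv_eq_sub
      (fun x _ => (contDiff_ramp.differentiable (by simp)).differentiableAt)
      (continuous_deriv_ramp.intervalIntegrable _ _), ramp_of_le le_rfl, ramp_of_ge le_rfl]
  norm_num

theorem pos_of_ramp_ne_zero {k t : ℝ} (hk : 0 < k) (h : ramp (k * t) ≠ 0) : 0 < t := by
  by_contra! h1
  exact h (ramp_of_le (by nlinarith))

theorem tendsto_ramp_of_pos {f : ℝ → ℝ} {a : ℝ} (hf : Filter.Tendsto f Filter.atTop (𝓝 a))
    (ha : 0 < a) : Filter.Tendsto (fun k => ramp (k * f k)) Filter.atTop (𝓝 1) := by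
  have h1 := Filter.Tendsto.atTop_mul_pos ha Filter.tendsto_id hf
  refine tendsto_const_nhds.congr' ?_
  filter_upwards [h1.eventually_ge_atTop 2] with k hk using (ramp_of_ge hk).symm

theorem tendsto_ramp_of_neg {f : ℝ → ℝ} {a : ℝ} (hf : Filter.Tendsto f Filter.atTop (𝓝 a))
    (ha : a < 0) : Filter.Tendsto (fun k => ramp (k * f k)) Filter.atTop (𝓝 0) := by
  have h1 := Filter.Tendsto.atTop_mul_neg ha Filter.tendsto_id hf
  refine tendsto_const_nhds.congr' ?_
  filter_upwards [h1.eventually_le_atBot 1] with k hk using (ramp_of_le hk).symm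

namespace Polytope

variable (K : Polytope d)

theorem isClosed_carrier : IsClosed K.carrier := K.isCompact_carrier.isClosed

theorem convex_carrier : Convex ℝ K.carrier := by
  have : K.carrier = ⋂ h ∈ K.halfspaces, {x : E d | inner ℝ h.1 x ≤ h.2} := by
    ext x; simp [carrier]
  rw [this]
  exact convex_iInter₂ fun h _ => convex_halfSpace_le (innerₛₗ ℝ h.1).isLinear _

theorem closure_interior : closure (interior K.carrier) = K.carrier := by
  rw [K.convex_carrier.closure_interior_eq_closure_of_nonempty_interior K.interior_nonempty,
    K.isClosed_carrier.closure_eq]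

theorem inner_lt_of_mem_interior {x : E d} (hx : x ∈ interior K.carrier) {h : E d × ℝ}
    (hh : h ∈ K.halfspaces) : inner ℝ h.1 x < h.2 := by
  have h1 : Filter.Tendsto (fun t : ℝ => x + t • h.1) (𝓝[>] 0) (𝓝 x) := by
    have : Continuous fun t : ℝ => x + t • h.1 := by fun_prop
    simpa using (this.tendsto 0).mono_left nhdsWithin_le_nhds
  obtain ⟨t, ht, ht0⟩ := ((h1.eventually (mem_interior_iff_mem_nhds.1 hx)).and
    self_mem_nhdsWithin).exists
  have h2 := ht h hh
  rw [inner_add_right, inner_smul_right, real_inner_self_eq_norm_sq, K.norm_normal h hh] at h2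
  have : (0 : ℝ) < t := ht0
  linarith

theorem mem_interior_iff {x : E d} :
    x ∈ interior K.carrier ↔ ∀ h ∈ K.halfspaces, inner ℝ h.1 x < h.2 := by
  refine ⟨fun hx h hh => K.inner_lt_of_mem_interior hx hh, fun hx => ?_⟩
  refine mem_interior.2 ⟨⋂ h ∈ K.halfspaces, {x : E d | inner ℝ h.1 x < h.2}, ?_, ?_,
    mem_iInter₂.2 hx⟩
  · intro y hy h hh
    simp only [mem_iInter] at hy
    exact (hy h hh).le
  · exact isOpen_biInter_finset fun h _ => isOpen_lt (by fun_prop) continuous_const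

theorem volume_carrier_diff_interior : volume (K.carrier \ interior K.carrier) = 0 := by
  have := K.convex_carrier.addHaar_frontier volume
  rwa [K.isClosed_carrier.frontier_eq] at this

theorem restrict_carrier_eq :
    volume.restrict K.carrier = volume.restrict (interior K.carrier) := by
  refine (Measure.restrict_congr_set ?_).symm
  refine Filter.EventuallyLE.antisymm (Filter.Eventually.of_forall interior_subset) ?_
  exact ae_le_set.2 K.volume_carrier_diff_interior

/-- Among the half-spaces of a polytope, distinct ones have distinct bounding hyperplanes:
the opposite half-space is excluded by the nonempty interior. -/
theorem not_proportional {h h' : E d × ℝ} (hh : h ∈ K.halfspaces) (hh' : h' ∈ K.halfspaces)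
    (hne : h' ≠ h) : ¬ ∃ t : ℝ, h'.1 = t • h.1 ∧ h'.2 = t * h.2 := by
  rintro ⟨t, h1, h2⟩
  have h3 : |t| = 1 := by
    have := congrArg norm h1
    rwa [norm_smul, K.norm_normal h hh, K.norm_normal h' hh', mul_one, Real.norm_eq_abs,
      eq_comm] at this
  rcases eq_or_eq_neg_of_abs_eq h3 with rfl | rfl
  · exact hne (Prod.ext (by simpa using h1) (by simpa using h2))
  · obtain ⟨x, hx⟩ := K.interior_nonempty
    have h4 := K.inner_lt_of_mem_interior hx hh
    have h5 := K.inner_lt_of_mem_interior hx hh'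
    rw [h1, h2, real_inner_smul_left] at h5
    linarith

theorem isClosed_facet (h : K.halfspaces) : IsClosed (K.facet h) :=
  K.isClosed_carrier.inter (isClosed_eq (by fun_prop) continuous_const)

theorem facet_subset (h : K.halfspaces) : K.facet h ⊆ {x | inner ℝ h.1.1 x = h.1.2} :=
  fun _ hx => hx.2

theorem facet_subset_carrier (h : K.halfspaces) : K.facet h ⊆ K.carrier := fun _ hx => hx.1

theorem facet_measure_lt_top (h : K.halfspaces) :
    Measure.euclideanHausdorffMeasure (d - 1) (K.facet h) < ⊤ :=
  measure_lt_top_of_subset_hyperplane (K.norm_normal _ h.2) _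
    (K.isBounded.subset (K.facet_subset_carrier h)) (K.facet_subset h)

/-- A smooth cutoff function for `k > 0`: on the polytope it equals one at distance at least `2 / k`
from all bounding hyperplanes, and its support lies in the interior. -/
def cutoff (k : ℝ) (x : E d) : ℝ := ∏ h ∈ K.halfspaces, ramp (k * (h.2 - inner ℝ h.1 x))

open Classical in
/-- The factor of the cutoff function that belongs to all half-spaces but `h`. -/
def cutoffErase (h : E d × ℝ) (k : ℝ) (x : E d) : ℝ :=
  ∏ h' ∈ K.halfspaces.erase h, ramp (k * (h'.2 - inner ℝ h'.1 x))

theorem contDiff_cutoff (k : ℝ) : ContDiff ℝ ∞ (K.cutoff k) :=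
  contDiff_prod fun h _ => contDiff_ramp.comp
    (contDiff_const.mul (contDiff_const.sub (innerSL ℝ h.1).contDiff))

theorem continuous_cutoffErase (h : E d × ℝ) (k : ℝ) : Continuous (K.cutoffErase h k) :=
  continuous_finsetProd _ fun h _ => contDiff_ramp.continuous.comp (by fun_prop)

theorem cutoff_nonneg (k : ℝ) (x : E d) : 0 ≤ K.cutoff k x :=
  Finset.prod_nonneg fun _ _ => ramp_nonneg _

theorem cutoff_le_one (k : ℝ) (x : E d) : K.cutoff k x ≤ 1 :=
  Finset.prod_le_one (fun _ _ => ramp_nonneg _) fun _ _ => ramp_le_one _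

theorem cutoffErase_nonneg (h : E d × ℝ) (k : ℝ) (x : E d) : 0 ≤ K.cutoffErase h k x :=
  Finset.prod_nonneg fun _ _ => ramp_nonneg _

theorem cutoffErase_le_one (h : E d × ℝ) (k : ℝ) (x : E d) : K.cutoffErase h k x ≤ 1 :=
  Finset.prod_le_one (fun _ _ => ramp_nonneg _) fun _ _ => ramp_le_one _

theorem tsupport_cutoff_subset {k : ℝ} (hk : 0 < k) :
    tsupport (K.cutoff k) ⊆ interior K.carrier := by
  have h1 : IsClosed (⋂ h ∈ K.halfspaces, {x : E d | 1 ≤ k * (h.2 - inner ℝ h.1 x)}) :=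
    isClosed_biInter fun h _ => isClosed_le continuous_const (by fun_prop)
  have h2 : tsupport (K.cutoff k) ⊆
      ⋂ h ∈ K.halfspaces, {x : E d | 1 ≤ k * (h.2 - inner ℝ h.1 x)} := by
    refine closure_minimal (fun x hx => ?_) h1
    simp only [mem_iInter, mem_ofPred_eq]
    intro h hh
    by_contra! h3
    exact hx (Finset.prod_eq_zero hh (ramp_of_le h3.le))
  refine h2.trans fun x hx => K.mem_interior_iff.2 fun h hh => ?_
  simp only [mem_iInter, mem_ofPred_eq] at hx
  have := hx h hh
  by_contra! h3
  nlinarith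

theorem tendsto_cutoff {x : E d} (hx : x ∈ interior K.carrier) :
    Filter.Tendsto (fun k => K.cutoff k x) Filter.atTop (𝓝 1) := by
  have : Filter.Tendsto (fun k => K.cutoff k x) Filter.atTop (𝓝 (∏ h ∈ K.halfspaces, (1 : ℝ))) :=
    tendsto_finsetProd _ fun h hh => tendsto_ramp_of_pos tendsto_const_nhds
      (sub_pos.2 (K.inner_lt_of_mem_interior hx hh))
  simpa using this

theorem fderiv_cutoff (k : ℝ) (x : E d) (i : Fin d) :
    fderiv ℝ (K.cutoff k) x (EuclideanSpace.single i 1) =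
      - ∑ h ∈ K.halfspaces, h.1 i *
        (k * deriv ramp (k * (h.2 - inner ℝ h.1 x)) * K.cutoffErase h k x) := by
  classical
  have h1 : ∀ h ∈ K.halfspaces, HasFDerivAt (fun x : E d => ramp (k * (h.2 - inner ℝ h.1 x)))
      (deriv ramp (k * (h.2 - inner ℝ h.1 x)) • (k • -(innerSL ℝ h.1))) x := by
    intro h _
    have h2 : HasFDerivAt (fun x : E d => k * (h.2 - inner ℝ h.1 x)) (k • -(innerSL ℝ h.1)) x :=
      (((innerSL ℝ h.1).hasFDerivAt (x := x)).const_sub h.2).const_mul k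
    exact (contDiff_ramp.differentiable (by simp)).differentiableAt.hasDerivAt.comp_hasFDerivAt
      x h2
  have h3 := HasFDerivAt.finsetProd h1
  have h4 : fderiv ℝ (K.cutoff k) x = _ := h3.fderiv
  rw [h4, sum_apply, ← Finset.sum_neg_distrib]
  refine Finset.sum_congr rfl fun h _ => ?_
  simp [cutoffErase, EuclideanSpace.inner_single_right]
  ring

end Polytope

/-! ### The Gauss-Green formula on convex polytopes -/

namespace Polytope

variable (K : Polytope d)

theorem mem_carrier_of_cutoffErase_ne_zero {h : E d × ℝ} {k : ℝ} {x : E d} (hk : 0 < k)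
    (hx : inner ℝ h.1 x ≤ h.2) (hne : K.cutoffErase h k x ≠ 0) : x ∈ K.carrier := by
  classical
  intro h' hh'
  by_cases heq : h' = h
  · rw [heq]; exact hx
  · have h1 := Finset.prod_ne_zero_iff.1 hne h' (Finset.mem_erase.2 ⟨heq, hh'⟩)
    linarith [pos_of_ramp_ne_zero hk h1]

/-- Off the hyperplanes of the other facets, `cutoffErase` tends to the indicator function of the
facet along points approaching the hyperplane of the facet. -/
theorem tendsto_cutoffErase {h : E d × ℝ} (hh : h ∈ K.halfspaces) {x : ℝ → E d} {x₀ : E d}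
    (hx : Filter.Tendsto x Filter.atTop (𝓝 x₀)) (hx₀ : inner ℝ h.1 x₀ = h.2)
    (hne : ∀ h' ∈ K.halfspaces, h' ≠ h → inner ℝ h'.1 x₀ ≠ h'.2) :
    Filter.Tendsto (fun k => K.cutoffErase h k (x k)) Filter.atTop
      (𝓝 ((K.facet ⟨h, hh⟩).indicator (fun _ => 1) x₀)) := by
  classical
  have h1 : ∀ h' ∈ K.halfspaces.erase h,
      Filter.Tendsto (fun k => ramp (k * (h'.2 - inner ℝ h'.1 (x k)))) Filter.atTop
        (𝓝 (if inner ℝ h'.1 x₀ < h'.2 then 1 else 0)) := by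
    intro h' hh'
    have h2 : Filter.Tendsto (fun k => h'.2 - inner ℝ h'.1 (x k)) Filter.atTop
        (𝓝 (h'.2 - inner ℝ h'.1 x₀)) := tendsto_const_nhds.sub (tendsto_const_nhds.inner hx)
    split_ifs with h3
    · exact tendsto_ramp_of_pos h2 (sub_pos.2 h3)
    · refine tendsto_ramp_of_neg h2 (sub_neg.2 (lt_of_le_of_ne (not_lt.1 h3) ?_))
      exact (hne h' (Finset.mem_of_mem_erase hh') (Finset.ne_of_mem_erase hh')).symm
  have h4 := tendsto_finsetProd _ h1
  convert! h4 using 2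
  rw [Finset.prod_ite_zero, Finset.prod_const_one, indicator_apply]
  refine if_congr ⟨fun hm h' hh' => ?_, fun hm => ⟨fun h' hh' => ?_, hx₀⟩⟩ rfl rfl
  · exact lt_of_le_of_ne (hm.1 h' (Finset.mem_of_mem_erase hh'))
      (hne h' (Finset.mem_of_mem_erase hh') (Finset.ne_of_mem_erase hh'))
  · by_cases heq : h' = h
    · rw [heq]; exact hx₀.le
    · exact (hm h' (Finset.mem_erase.2 ⟨heq, hh'⟩)).le

theorem continuous_layer (h : E d × ℝ) {W : E d → ℝ} (hW : Continuous W) (k : ℝ) :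
    Continuous fun x =>
      W x * (k * deriv ramp (k * (h.2 - inner ℝ h.1 x)) * K.cutoffErase h k x) :=
  hW.mul ((continuous_const.mul
    (continuous_deriv_ramp.comp (by fun_prop))).mul (K.continuous_cutoffErase h k))

theorem hasCompactSupport_layer {h : E d × ℝ} (W : E d → ℝ) {k : ℝ} (hk : 0 < k) :
    HasCompactSupport fun x =>
      W x * (k * deriv ramp (k * (h.2 - inner ℝ h.1 x)) * K.cutoffErase h k x) := by
  refine HasCompactSupport.intro K.isCompact_carrier fun x hx => ?_
  by_contra hne
  have h1 : K.cutoffErase h k x ≠ 0 := fun h0 => hne (by simp [h0])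
  have h2 : k * (h.2 - inner ℝ h.1 x) ∈ Icc (1 : ℝ) 2 := by
    by_contra h0
    exact hne (by simp [deriv_ramp_of_notMem h0])
  refine hx (K.mem_carrier_of_cutoffErase_ne_zero hk ?_ h1)
  by_contra! h3
  nlinarith [h2.1]

/-- Slicing the boundary layer of a facet by hyperplanes parallel to it, in the stretched normal
variable `s = k (c - t)`. -/
theorem integral_layer_eq {h : E d × ℝ} (hh : h ∈ K.halfspaces) {W : E d → ℝ}
    (hW : Continuous W) {k : ℝ} (hk : 0 < k) :
    ∫ x, W x * (k * deriv ramp (k * (h.2 - inner ℝ h.1 x)) * K.cutoffErase h k x) =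
      ∫ s, deriv ramp s * ∫ y : (ℝ ∙ h.1)ᗮ, W ((h.2 - s / k) • h.1 + (y : E d)) *
        K.cutoffErase h k ((h.2 - s / k) • h.1 + (y : E d)) := by
  have hn := K.norm_normal h hh
  set G : E d → ℝ := fun x =>
    W x * (k * deriv ramp (k * (h.2 - inner ℝ h.1 x)) * K.cutoffErase h k x) with hG
  have hGc : Continuous G := K.continuous_layer h hW k
  have hGs : HasCompactSupport G := K.hasCompactSupport_layer W hk
  have hmp := measurePreserving_smul_add hn
  have h1 : ∫ x, G x = ∫ t : ℝ, ∫ y : (ℝ ∙ h.1)ᗮ, G (t • h.1 + (y : E d)) := by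
    rw [← hmp.map_eq, integral_map hmp.measurable.aemeasurable hGc.aestronglyMeasurable]
    exact integral_prod (fun p : ℝ × (ℝ ∙ h.1)ᗮ => G (p.1 • h.1 + (p.2 : E d)))
      ((hmp.integrable_comp hGc.aestronglyMeasurable).2
      (hGc.integrable_of_hasCompactSupport hGs))
  set B : ℝ → ℝ := fun t => ∫ y : (ℝ ∙ h.1)ᗮ, G (t • h.1 + (y : E d)) with hB
  -- the factor `k` of the stretching cancels the one in the layer density
  have h2 : ∫ s, B (h.2 - s / k) = k * ∫ t, B t := by
    rw [Measure.integral_comp_div (fun s => B (h.2 - s)) k, integral_sub_left_eq_self,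
      abs_of_pos hk, smul_eq_mul]
  have h3 : ∀ s, B (h.2 - s / k) = k * (deriv ramp s *
      ∫ y : (ℝ ∙ h.1)ᗮ, W ((h.2 - s / k) • h.1 + (y : E d)) *
        K.cutoffErase h k ((h.2 - s / k) • h.1 + (y : E d))) := by
    intro s
    rw [← mul_assoc, ← integral_const_mul]
    refine integral_congr_ae (Filter.Eventually.of_forall fun y => ?_)
    simp only [hG, inner_smul_add hn]
    have : k * (h.2 - (h.2 - s / k)) = s := by field_simp; ring
    rw [this]
    ring
  simp_rw [h3] at h2
  rw [integral_const_mul] at h2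
  rw [h1]
  exact (mul_left_cancel₀ hk.ne' h2).symm

/-- The slices of the boundary layer converge to the facet: the integrals of a continuous function
against the layer density converge to its surface integral. -/
theorem tendsto_integral_layer {h : E d × ℝ} (hh : h ∈ K.halfspaces) {W : E d → ℝ}
    (hW : Continuous W) :
    Filter.Tendsto (fun k : ℝ => ∫ x, W x * (k * deriv ramp (k * (h.2 - inner ℝ h.1 x)) *
      K.cutoffErase h k x)) Filter.atTop
      (𝓝 (∫ x in K.facet ⟨h, hh⟩, W x ∂(Measure.euclideanHausdorffMeasure (d - 1)))) := by
  have hn := K.norm_normal h hh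
  obtain ⟨C, hC⟩ := K.isCompact_carrier.exists_bound_of_continuousOn hW.continuousOn
  obtain ⟨R, hR⟩ := K.isBounded.exists_norm_le
  set ρ : (ℝ ∙ h.1)ᗮ → ℝ := (Metric.closedBall 0 (2 * R)).indicator fun _ => C with hρ
  have hρi : Integrable ρ :=
    (integrable_indicator_iff Metric.isClosed_closedBall.measurableSet).2
      (integrableOn_const (isCompact_closedBall _ _).measure_lt_top.ne)
  have hC0 : 0 ≤ C := by
    obtain ⟨x, hx⟩ := K.interior_nonempty
    exact (norm_nonneg _).trans (hC x (interior_subset hx))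
  set w : ℝ → ℝ → (ℝ ∙ h.1)ᗮ → ℝ := fun k s y => W ((h.2 - s / k) • h.1 + (y : E d)) *
        K.cutoffErase h k ((h.2 - s / k) • h.1 + (y : E d)) with hw
  have hwc : ∀ k, Continuous fun p : ℝ × (ℝ ∙ h.1)ᗮ => w k p.1 p.2 := fun k =>
    (hW.comp (by fun_prop)).mul ((K.continuous_cutoffErase h k).comp (by fun_prop))
  -- for `s > 0` the slice at height `h.2 - s / k` lies on the inner side of the facet, so that the
  -- integrand is supported in the polytope
  have hbound : ∀ k s, 0 < k → 0 < s → ∀ y, ‖w k s y‖ ≤ ρ y := by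
    intro k s hk hs y
    set x := (h.2 - s / k) • h.1 + (y : E d) with hx
    have hin : inner ℝ h.1 x = h.2 - s / k := inner_smul_add hn _ _
    by_cases h0 : K.cutoffErase h k x = 0
    · have h1 : w k s y = 0 := by simp [hw, ← hx, h0]
      rw [h1, norm_zero]
      exact indicator_nonneg (fun _ _ => hC0) _
    · have hxK : x ∈ K.carrier := by
        refine K.mem_carrier_of_cutoffErase_ne_zero hk ?_ h0
        have := div_pos hs hk
        rw [hin]; linarith
      have hy : y ∈ Metric.closedBall (0 : (ℝ ∙ h.1)ᗮ) (2 * R) := by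
        have h2 : (y : E d) = x - (inner ℝ h.1 x : ℝ) • h.1 := by rw [hin, hx]; simp
        have h3 : |(inner ℝ h.1 x : ℝ)| ≤ R :=
          (abs_real_inner_le_norm _ _).trans (by rw [hn, one_mul]; exact hR x hxK)
        rw [mem_closedBall_zero_iff]
        change ‖(y : E d)‖ ≤ 2 * R
        rw [h2]
        refine (norm_sub_le _ _).trans ?_
        rw [norm_smul, hn, mul_one, Real.norm_eq_abs]
        linarith [hR x hxK]
      rw [hρ, indicator_of_mem hy]
      have : ‖w k s y‖ = ‖W x‖ * K.cutoffErase h k x := by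
        simp only [hw, ← hx, norm_mul]
        rw [Real.norm_of_nonneg (K.cutoffErase_nonneg h k x)]
      rw [this]
      calc ‖W x‖ * K.cutoffErase h k x ≤ ‖W x‖ * 1 :=
            mul_le_mul_of_nonneg_left (K.cutoffErase_le_one h k x) (norm_nonneg _)
        _ ≤ C := by rw [mul_one]; exact hC x hxK
  have hlim : ∀ s, 0 < s → Filter.Tendsto (fun k => ∫ y, w k s y) Filter.atTop
      (𝓝 (∫ x in K.facet ⟨h, hh⟩, W x ∂(Measure.euclideanHausdorffMeasure (d - 1)))) := by
    intro s hs
    rw [setIntegral_hyperplane hn h.2 (K.isClosed_facet ⟨h, hh⟩).measurableSet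
      (K.facet_subset ⟨h, hh⟩) W]
    refine tendsto_integral_filter_of_dominated_convergence ρ ?_ ?_ hρi ?_
    · exact Filter.Eventually.of_forall fun k =>
        ((hwc k).comp (Continuous.prodMk_right s)).aestronglyMeasurable
    · filter_upwards [Filter.eventually_gt_atTop 0] with k hk
      exact Filter.Eventually.of_forall (hbound k s hk hs)
    · have hne : ∀ᵐ y : (ℝ ∙ h.1)ᗮ, ∀ h' ∈ K.halfspaces, h' ≠ h →
          inner ℝ h'.1 (h.2 • h.1 + (y : E d)) ≠ h'.2 := by
        rw [Filter.eventually_all_finset]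
        intro h' hh'
        by_cases heq : h' = h
        · simp [heq]
        · filter_upwards [ae_inner_smul_add_ne hn (K.not_proportional hh hh' heq)] with y hy _
            using hy
      filter_upwards [hne] with y hy
      have hx : Filter.Tendsto (fun k : ℝ => (h.2 - s / k) • h.1 + (y : E d)) Filter.atTop
          (𝓝 (h.2 • h.1 + (y : E d))) := by
        have : Filter.Tendsto (fun k : ℝ => h.2 - s / k) Filter.atTop (𝓝 (h.2 - 0)) :=
          tendsto_const_nhds.sub (tendsto_const_nhds.div_atTop Filter.tendsto_id)
        rw [sub_zero] at this
        exact (this.smul_const _).add_const _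
      have h1 := ((hW.tendsto _).comp hx).mul
        (K.tendsto_cutoffErase hh hx (inner_smul_add hn _ _) hy)
      convert! h1 using 2
      by_cases hm : h.2 • h.1 + (y : E d) ∈ K.facet ⟨h, hh⟩ <;> simp [hm]
  have hmain : Filter.Tendsto (fun k => ∫ s, deriv ramp s * ∫ y, w k s y) Filter.atTop
      (𝓝 (∫ s, deriv ramp s *
        ∫ x in K.facet ⟨h, hh⟩, W x ∂(Measure.euclideanHausdorffMeasure (d - 1)))) := by
    refine tendsto_integral_filter_of_dominated_convergence
      (fun s => ‖deriv ramp s‖ * ∫ y, ρ y) ?_ ?_ ?_ ?_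
    · exact Filter.Eventually.of_forall fun k => continuous_deriv_ramp.aestronglyMeasurable.mul
        (hwc k).stronglyMeasurable.integral_prod_right'.aestronglyMeasurable
    · filter_upwards [Filter.eventually_gt_atTop 0] with k hk
      refine Filter.Eventually.of_forall fun s => ?_
      by_cases hs : s ∈ Icc (1 : ℝ) 2
      · rw [norm_mul]
        refine mul_le_mul_of_nonneg_left ?_ (norm_nonneg _)
        exact norm_integral_le_of_norm_le hρi
          (Filter.Eventually.of_forall (hbound k s hk (by linarith [hs.1])))
      · simp [deriv_ramp_of_notMem hs]
    · exact (continuous_deriv_ramp.integrable_of_hasCompactSupport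
        hasCompactSupport_deriv_ramp).norm.mul_const _
    · refine Filter.Eventually.of_forall fun s => ?_
      by_cases hs : s ∈ Icc (1 : ℝ) 2
      · exact (hlim s (by linarith [hs.1])).const_mul _
      · simp [deriv_ramp_of_notMem hs]
  rw [integral_mul_const, integral_deriv_ramp, one_mul] at hmain
  refine hmain.congr' ?_
  filter_upwards [Filter.eventually_gt_atTop 0] with k hk
  exact (K.integral_layer_eq hh hW hk).symm

theorem integrableOn_interior {f : E d → ℝ} (hf : Continuous f) :
    IntegrableOn f (interior K.carrier) :=
  (hf.continuousOn.integrableOn_compact K.isCompact_carrier).mono_set interior_subset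

theorem integrableOn_interior_mul {f g : E d → ℝ} (hg : IntegrableOn g (interior K.carrier))
    (hf : Continuous f) : IntegrableOn (fun x => g x * f x) (interior K.carrier) := by
  obtain ⟨C, hC⟩ := K.isCompact_carrier.exists_bound_of_continuousOn hf.continuousOn
  refine Integrable.mul_bdd (c := C) hg hf.aestronglyMeasurable ?_
  exact (ae_restrict_iff' isOpen_interior.measurableSet).2
    (Filter.Eventually.of_forall fun x hx => hC x (interior_subset hx))

/-- The weak derivative tested with `cutoff k * ψ`. -/
theorem integral_mul_cutoff {i : Fin d} {F g ψ : E d → ℝ} (hF : Continuous F)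
    (hg : IntegrableOn g (interior K.carrier)) (hFg : IsWeakPartial (interior K.carrier) i F g)
    (hψ : ContDiff ℝ ∞ ψ) {k : ℝ} (hk : 0 < k) :
    ∫ x in interior K.carrier,
        (g x * ψ x + F x * fderiv ℝ ψ x (EuclideanSpace.single i 1)) * K.cutoff k x =
      - ∫ x, F x * ψ x * fderiv ℝ (K.cutoff k) x (EuclideanSpace.single i 1) := by
  have hχ := K.contDiff_cutoff k
  have hψ' : Continuous fun x => fderiv ℝ ψ x (EuclideanSpace.single i 1) :=
    (hψ.continuous_fderiv (by simp)).clm_apply continuous_const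
  have hχ' : Continuous fun x => fderiv ℝ (K.cutoff k) x (EuclideanSpace.single i 1) :=
    (hχ.continuous_fderiv (by simp)).clm_apply continuous_const
  have hsub : tsupport (fun x => K.cutoff k x * ψ x) ⊆ interior K.carrier :=
    (tsupport_mul_subset_left).trans (K.tsupport_cutoff_subset hk)
  have h1 := hFg.2.2 (fun x => K.cutoff k x * ψ x) (hχ.mul hψ)
    (K.isCompact_carrier.of_isClosed_subset (isClosed_tsupport _) (hsub.trans interior_subset)) hsub
  have h2 : ∀ x, fderiv ℝ (fun x => K.cutoff k x * ψ x) x (EuclideanSpace.single i 1) =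
      K.cutoff k x * fderiv ℝ ψ x (EuclideanSpace.single i 1) +
        ψ x * fderiv ℝ (K.cutoff k) x (EuclideanSpace.single i 1) := by
    intro x
    rw [fderiv_fun_mul (hχ.differentiable (by simp)).differentiableAt
      (hψ.differentiable (by simp)).differentiableAt]
    rfl
  generalize (EuclideanSpace.single i (1 : ℝ) : E d) = e at *
  have hI1 : IntegrableOn (fun x => F x * (K.cutoff k x * fderiv ℝ ψ x e))
      (interior K.carrier) := K.integrableOn_interior (hF.mul (hχ.continuous.mul hψ'))
  have hI2 : IntegrableOn (fun x => F x * ψ x * fderiv ℝ (K.cutoff k) x e)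
      (interior K.carrier) := K.integrableOn_interior ((hF.mul hψ.continuous).mul hχ')
  have hI3 : IntegrableOn (fun x => g x * (K.cutoff k x * ψ x)) (interior K.carrier) :=
    K.integrableOn_interior_mul hg (hχ.continuous.mul hψ.continuous)
  have h4 : (∫ x in interior K.carrier, F x * (K.cutoff k x * fderiv ℝ ψ x e)) +
      ∫ x in interior K.carrier, F x * ψ x * fderiv ℝ (K.cutoff k) x e =
      - ∫ x in interior K.carrier, g x * (K.cutoff k x * ψ x) := by
    rw [← h1, ← integral_add hI1 hI2]
    refine integral_congr_ae (Filter.Eventually.of_forall fun x => ?_)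
    simp only [h2]
    ring
  have h5 : ∫ x in interior K.carrier, (g x * ψ x + F x * fderiv ℝ ψ x e) * K.cutoff k x =
      (∫ x in interior K.carrier, g x * (K.cutoff k x * ψ x)) +
      ∫ x in interior K.carrier, F x * (K.cutoff k x * fderiv ℝ ψ x e) := by
    rw [← integral_add hI3 hI1]
    refine integral_congr_ae (Filter.Eventually.of_forall fun x => ?_)
    simp only
    ring
  have h6 : ∀ x, x ∉ interior K.carrier →
      F x * ψ x * fderiv ℝ (K.cutoff k) x e = 0 := by
    intro x hx
    have h7 : fderiv ℝ (K.cutoff k) x = 0 :=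
      fderiv_of_notMem_tsupport ℝ (fun hx' => hx (K.tsupport_cutoff_subset hk hx'))
    simp [h7]
  rw [setIntegral_eq_integral_of_forall_compl_eq_zero h6] at h4
  linarith

/-- The derivative of the cutoff function is a sum of layer densities, one for each facet. -/
theorem integral_mul_fderiv_cutoff {i : Fin d} {W : E d → ℝ} (hW : Continuous W)
    {k : ℝ} (hk : 0 < k) :
    ∫ x, W x * fderiv ℝ (K.cutoff k) x (EuclideanSpace.single i 1) =
      - ∑ h : K.halfspaces, h.1.1 i * ∫ x, W x * (k * deriv ramp (k * (h.1.2 - inner ℝ h.1.1 x)) *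
        K.cutoffErase h.1 k x) := by
  simp_rw [← integral_const_mul]
  rw [← integral_finsetSum _ fun h _ => ((K.continuous_layer h.1
    hW k).integrable_of_hasCompactSupport (K.hasCompactSupport_layer W hk)).const_mul _,
    ← integral_neg]
  refine integral_congr_ae (Filter.Eventually.of_forall fun x => ?_)
  simp only [K.fderiv_cutoff k x i, mul_neg, Finset.mul_sum]
  rw [← Finset.sum_coe_sort K.halfspaces]
  refine congrArg _ (Finset.sum_congr rfl fun h _ => ?_)
  ring

/-- **Gauss-Green formula** on a convex polytope, for a continuous function with an integrable
weak partial derivative in the interior. -/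
theorem integral_weakPartial_mul_add {i : Fin d} {F g ψ : E d → ℝ} (hF : Continuous F)
    (hg : IntegrableOn g (interior K.carrier)) (hFg : IsWeakPartial (interior K.carrier) i F g)
    (hψ : ContDiff ℝ ∞ ψ) :
    ∫ x in interior K.carrier,
        (g x * ψ x + F x * fderiv ℝ ψ x (EuclideanSpace.single i 1)) =
      ∑ h : K.halfspaces, h.1.1 i *
        ∫ x in K.facet h, F x * ψ x ∂(Measure.euclideanHausdorffMeasure (d - 1)) := by
  have hψ' : Continuous fun x => fderiv ℝ ψ x (EuclideanSpace.single i 1) :=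
    (hψ.continuous_fderiv (by simp)).clm_apply continuous_const
  set H : E d → ℝ := fun x => g x * ψ x + F x * fderiv ℝ ψ x (EuclideanSpace.single i 1) with hH
  have hHi : IntegrableOn H (interior K.carrier) :=
    (K.integrableOn_interior_mul hg hψ.continuous).add (K.integrableOn_interior (hF.mul hψ'))
  have hleft : Filter.Tendsto (fun k => ∫ x in interior K.carrier, H x * K.cutoff k x)
      Filter.atTop (𝓝 (∫ x in interior K.carrier, H x)) := by
    refine tendsto_integral_filter_of_dominated_convergence (fun x => ‖H x‖) ?_ ?_ hHi.norm ?_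
    · exact Filter.Eventually.of_forall fun k => hHi.aestronglyMeasurable.mul
        (K.contDiff_cutoff k).continuous.aestronglyMeasurable
    · refine Filter.Eventually.of_forall fun k => Filter.Eventually.of_forall fun x => ?_
      rw [norm_mul, Real.norm_of_nonneg (K.cutoff_nonneg k x)]
      exact mul_le_of_le_one_right (norm_nonneg _) (K.cutoff_le_one k x)
    · refine (ae_restrict_iff' isOpen_interior.measurableSet).2
        (Filter.Eventually.of_forall fun x hx => ?_)
      simpa using (K.tendsto_cutoff hx).const_mul (H x)
  have hW : Continuous fun x => F x * ψ x := hF.mul hψ.continuous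
  have hright := tendsto_finsetSum (Finset.univ : Finset K.halfspaces) fun h _ =>
    (K.tendsto_integral_layer h.2 hW).const_mul (h.1.1 i)
  refine tendsto_nhds_unique (hleft.congr' ?_) hright
  filter_upwards [Filter.eventually_gt_atTop 0] with k hk
  rw [hH, K.integral_mul_cutoff hF hg hFg hψ hk,
    K.integral_mul_fderiv_cutoff hW hk, neg_neg]

end Polytope

/-! ### Facets of adjacent elements -/

namespace Polytope

/-- If the interiors of two polytopes are disjoint and the second one meets a facet of the first
in positive measure, then the opposite half-space of that facet belongs to the second. -/
theorem neg_mem_halfspaces {K L : Polytope d}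
    (hKL : Disjoint (interior K.carrier) (interior L.carrier)) {h : E d × ℝ}
    (hh : h ∈ K.halfspaces)
    (hpos : Measure.euclideanHausdorffMeasure (d - 1) (K.facet ⟨h, hh⟩ ∩ L.carrier) ≠ 0) :
    -h ∈ L.halfspaces := by
  have hn := K.norm_normal h hh
  obtain ⟨f, u, hfK, hfL⟩ := geometric_hahn_banach_open_open K.convex_carrier.interior
    isOpen_interior L.convex_carrier.interior isOpen_interior hKL
  have hfK' : ∀ x ∈ K.carrier, f x ≤ u := by
    rw [← K.closure_interior]
    exact fun x hx => closure_minimal (fun y hy => (hfK y hy).le)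
      (isClosed_le f.continuous continuous_const) hx
  have hfL' : ∀ x ∈ L.carrier, u ≤ f x := by
    rw [← L.closure_interior]
    exact fun x hx => closure_minimal (fun y hy => (hfL y hy).le)
      (isClosed_le continuous_const f.continuous) hx
  obtain ⟨m, rfl⟩ := (InnerProductSpace.toDual ℝ (E d)).surjective f
  simp only [InnerProductSpace.toDual_apply_apply] at *
  -- the separating hyperplane is the hyperplane of the facet
  obtain ⟨t, rfl, rfl⟩ : ∃ t : ℝ, m = t • h.1 ∧ u = t * h.2 := by
    by_contra hcon
    refine hpos (measure_mono_null ?_ (hyperplane_inter_null hn hcon))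
    exact fun x hx => ⟨hx.1.2, le_antisymm (hfK' x hx.1.1) (hfL' x hx.2)⟩
  simp only [real_inner_smul_left] at *
  have ht : 0 < t := by
    obtain ⟨a, ha⟩ := K.interior_nonempty
    have h1 := hfK a ha
    have h2 := K.inner_lt_of_mem_interior ha hh
    by_contra! h3
    nlinarith
  have hL : ∀ x ∈ interior L.carrier, h.2 < inner ℝ h.1 x := fun x hx =>
    lt_of_mul_lt_mul_left (hfL x hx) ht.le
  obtain ⟨h', hh', t', h1, h2⟩ : ∃ h' ∈ L.halfspaces, ∃ t' : ℝ,
      h'.1 = t' • h.1 ∧ h'.2 = t' * h.2 := by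
    by_contra! hcon
    refine hpos (measure_mono_null (t := ⋃ h' ∈ L.halfspaces,
      {x : E d | inner ℝ h.1 x = h.2} ∩ {x | inner ℝ h'.1 x = h'.2}) ?_ ?_)
    · intro x hx
      by_contra hx'
      simp only [mem_iUnion, not_exists] at hx'
      have hxi : x ∈ interior L.carrier := L.mem_interior_iff.2 fun h' hh' =>
        lt_of_le_of_ne (hx.2 h' hh') fun heq => hx' h' hh' ⟨hx.1.2, heq⟩
      exact (hL x hxi).ne' hx.1.2
    · exact (measure_biUnion_null_iff L.halfspaces.countable_toSet).2 fun h' hh' =>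
        hyperplane_inter_null hn fun ⟨t', h1, h2⟩ => hcon h' hh' t' h1 h2
  have h3 : |t'| = 1 := by
    have := congrArg norm h1
    rwa [norm_smul, hn, L.norm_normal h' hh', mul_one, Real.norm_eq_abs, eq_comm] at this
  -- the sign is negative, as the interior of `L` lies beyond the hyperplane
  rcases eq_or_eq_neg_of_abs_eq h3 with rfl | rfl
  · obtain ⟨b, hb⟩ := L.interior_nonempty
    have h4 := hL b hb
    have h5 := L.inner_lt_of_mem_interior hb hh'
    rw [h1, h2, one_smul, one_mul] at h5
    linarith
  · convert! hh'
    exact Prod.ext (by simpa using h1.symm) (by simpa using h2.symm)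

theorem neg_notMem_halfspaces {K : Polytope d} {h : E d × ℝ} (hh : h ∈ K.halfspaces) :
    -h ∉ K.halfspaces := fun hh' => by
  obtain ⟨x, hx⟩ := K.interior_nonempty
  have h1 := K.inner_lt_of_mem_interior hx hh
  have h2 := K.inner_lt_of_mem_interior hx hh'
  simp only [Prod.fst_neg, Prod.snd_neg, inner_neg_left] at h2
  linarith

theorem facet_inter_carrier_subset {K L : Polytope d} {h : E d × ℝ} (hh : h ∈ K.halfspaces)
    (hh' : -h ∈ L.halfspaces) :
    K.facet ⟨h, hh⟩ ∩ L.carrier ⊆ L.facet ⟨-h, hh'⟩ := fun x hx =>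
  ⟨hx.2, by simpa [inner_neg_left] using hx.1.2⟩

/-- At almost every point of a facet at most one further element is present: two of them would lie
on the same side. -/
theorem facet_inter_inter_null {K L M : Polytope d}
    (hKL : Disjoint (interior K.carrier) (interior L.carrier))
    (hKM : Disjoint (interior K.carrier) (interior M.carrier))
    (hLM : Disjoint (interior L.carrier) (interior M.carrier)) (h : K.halfspaces) :
    Measure.euclideanHausdorffMeasure (d - 1) (K.facet h ∩ L.carrier ∩ M.carrier) = 0 := by
  by_contra hpos
  have h1 : -h.1 ∈ L.halfspaces := neg_mem_halfspaces hKL h.2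
    fun h0 => hpos (measure_mono_null inter_subset_left h0)
  have h2 : -h.1 ∈ M.halfspaces := neg_mem_halfspaces hKM h.2
    fun h0 => hpos (measure_mono_null (inter_subset_inter_left _ inter_subset_left) h0)
  have h3 : - -h.1 ∈ M.halfspaces := neg_mem_halfspaces hLM h1 fun h0 => hpos
    (measure_mono_null (inter_subset_inter_left _ (facet_inter_carrier_subset h.2 h1)) h0)
  exact neg_notMem_halfspaces h2 h3

theorem facet_inter_facet_null (K : Polytope d) {h h' : K.halfspaces} (hne : h ≠ h') :
    Measure.euclideanHausdorffMeasure (d - 1) (K.facet h ∩ K.facet h') = 0 :=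
  measure_mono_null (inter_subset_inter (K.facet_subset h) (K.facet_subset h'))
    (hyperplane_inter_null (K.norm_normal _ h.2)
      (K.not_proportional h.2 h'.2 fun h0 => hne (Subtype.ext h0.symm)))

end Polytope

namespace Mesh

variable {Ω : Set (E d)} (T : Mesh Ω)

theorem carrier_subset_closure (j : Fin T.numCells) : (T.cell j).carrier ⊆ closure Ω := by
  rw [← T.iUnion_eq]
  exact subset_iUnion (fun j => (T.cell j).carrier) j

/-- Inside `Ω`, each facet point belongs to a second element: otherwise the closed union of the
other elements would miss a neighbourhood of it, which would then lie in the element. -/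
theorem exists_mem_other_cell (hΩ : IsOpen Ω) {j : Fin T.numCells} {h : (T.cell j).halfspaces}
    {x : E d} (hx : x ∈ (T.cell j).facet h) (hxΩ : x ∈ Ω) :
    ∃ k, k ≠ j ∧ x ∈ (T.cell k).carrier := by
  by_contra! hcon
  have h1 : IsClosed (⋃ k ∈ ({j}ᶜ : Set (Fin T.numCells)), (T.cell k).carrier) :=
    (Set.toFinite _).isClosed_biUnion fun k _ => (T.cell k).isClosed_carrier
  have h2 : Ω ∩ (⋃ k ∈ ({j}ᶜ : Set (Fin T.numCells)), (T.cell k).carrier)ᶜ ⊆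
      (T.cell j).carrier := by
    rintro y ⟨hyΩ, hy⟩
    have h3 : y ∈ ⋃ k, (T.cell k).carrier := by rw [T.iUnion_eq]; exact subset_closure hyΩ
    obtain ⟨k, hk⟩ := mem_iUnion.1 h3
    by_cases hkj : k = j
    · rwa [hkj] at hk
    · exact absurd (mem_biUnion (show k ∈ ({j}ᶜ : Set _) from hkj) hk) hy
  have h4 : x ∈ interior (T.cell j).carrier := by
    refine mem_interior.2 ⟨_, h2, hΩ.inter h1.isOpen_compl, hxΩ, ?_⟩
    simp only [mem_compl_iff, mem_iUnion, not_exists]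
    exact fun k hk => hcon k hk
  exact ((T.cell j).inner_lt_of_mem_interior h4 h.2).ne hx.2

theorem measurableSet_interiorFaceSet (hΩ : IsOpen Ω)
    (a : (Σ j : Fin T.numCells, (T.cell j).halfspaces) × Fin T.numCells) :
    MeasurableSet (T.interiorFaceSet a) :=
  (((T.cell a.1.1).isClosed_facet a.1.2).measurableSet.inter
    (T.cell a.2).isClosed_carrier.measurableSet).inter hΩ.measurableSet

theorem integrableOn_facet {K : Polytope d} {h : K.halfspaces} {s : Set (E d)}
    (hs : s ⊆ K.facet h) {f : E d → ℝ} (hf : Continuous f) :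
    IntegrableOn f s (Measure.euclideanHausdorffMeasure (d - 1)) := by
  obtain ⟨C, hC⟩ := K.isCompact_carrier.exists_bound_of_continuousOn hf.continuousOn
  have h1 : IntegrableOn f (K.facet h) (Measure.euclideanHausdorffMeasure (d - 1)) :=
    Measure.integrableOn_of_bounded (M := C) (K.facet_measure_lt_top h).ne
      hf.aestronglyMeasurable
      ((ae_restrict_iff' (K.isClosed_facet h).measurableSet).2
        (Filter.Eventually.of_forall fun x hx => hC x hx.1))
  exact h1.mono_set hs

/-- A facet is, up to null sets, the disjoint union of its boundary part and of the parts shared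
with the other elements. -/
theorem facet_integral_eq (hΩ : IsOpen Ω) (j : Fin T.numCells) (h : (T.cell j).halfspaces)
    {w : E d → ℝ} (hw : Continuous w) :
    ∫ x in (T.cell j).facet h, w x ∂(Measure.euclideanHausdorffMeasure (d - 1)) =
      (∫ x in T.boundaryFaceSet ⟨j, h⟩, w x ∂(Measure.euclideanHausdorffMeasure (d - 1))) +
      ∑ k, if k = j then 0 else
        ∫ x in T.interiorFaceSet ⟨⟨j, h⟩, k⟩, w x ∂(Measure.euclideanHausdorffMeasure (d - 1)) := by
  classical
  set μ : Measure (E d) := Measure.euclideanHausdorffMeasure (d - 1)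
  set s : Fin T.numCells → Set (E d) := fun k => if k = j then ∅ else T.interiorFaceSet ⟨⟨j, h⟩, k⟩
    with hs
  have hsub : ∀ k, s k ⊆ T.interiorFaceSet ⟨⟨j, h⟩, k⟩ := by
    intro k
    simp only [hs]
    split_ifs
    · exact empty_subset _
    · exact Subset.rfl
  have hsm : ∀ k, MeasurableSet (s k) := by
    intro k
    simp only [hs]
    split_ifs
    · exact MeasurableSet.empty
    · exact T.measurableSet_interiorFaceSet hΩ _
  have hU : (T.cell j).facet h = T.boundaryFaceSet ⟨j, h⟩ ∪ ⋃ k, s k := by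
    apply Subset.antisymm
    · intro x hx
      by_cases hxΩ : x ∈ Ω
      · right
        obtain ⟨k, hkj, hk⟩ := T.exists_mem_other_cell hΩ hx hxΩ
        refine mem_iUnion.2 ⟨k, ?_⟩
        simp only [hs, if_neg hkj]
        exact ⟨⟨hx, hk⟩, hxΩ⟩
      · left
        refine ⟨hx, ?_⟩
        rw [hΩ.frontier_eq]
        exact ⟨T.carrier_subset_closure j hx.1, hxΩ⟩
    · refine union_subset inter_subset_left (iUnion_subset fun k => (hsub k).trans ?_)
      exact fun x hx => hx.1.1
  have hdisj : Disjoint (T.boundaryFaceSet ⟨j, h⟩) (⋃ k, s k) := by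
    rw [disjoint_iUnion_right]
    refine fun k => Disjoint.mono inter_subset_right ((hsub k).trans inter_subset_right) ?_
    rw [hΩ.frontier_eq]
    exact disjoint_sdiff_left
  have hae : Pairwise fun k l => AEDisjoint μ (s k) (s l) := by
    intro k l hkl
    by_cases hk : k = j
    · simp [hs, hk, AEDisjoint]
    by_cases hl : l = j
    · simp [hs, hl, AEDisjoint]
    refine measure_mono_null ?_ (Polytope.facet_inter_inter_null (T.disjoint j k (Ne.symm hk))
      (T.disjoint j l (Ne.symm hl)) (T.disjoint k l hkl) h)
    exact fun x hx => ⟨((hsub k) hx.1).1, ((hsub l) hx.2).1.2⟩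
  have hfac : ⋃ k, s k ⊆ (T.cell j).facet h := by rw [hU]; exact subset_union_right
  rw [hU, setIntegral_union hdisj (MeasurableSet.iUnion hsm)
    (integrableOn_facet (s := T.boundaryFaceSet ⟨j, h⟩) inter_subset_left hw)
    (integrableOn_facet hfac hw),
    integral_iUnion_ae (fun k => (hsm k).nullMeasurableSet) hae (integrableOn_facet hfac hw),
    tsum_fintype]
  congr 1
  refine Finset.sum_congr rfl fun k _ => ?_
  simp only [hs]
  split_ifs <;> simp

end Mesh

/-! ### Surface integrals over the mesh -/

namespace Mesh

variable {Ω : Set (E d)} (T : Mesh Ω)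

/-- The flux through the common boundary of two elements changes its sign when the elements are
exchanged, because their facets carry opposite normals. -/
theorem sum_interiorFaceSet_swap (i : Fin d) {j k : Fin T.numCells} (hjk : j ≠ k) (w : E d → ℝ) :
    ∑ h : (T.cell j).halfspaces, h.1.1 i * ∫ x in T.interiorFaceSet ⟨⟨j, h⟩, k⟩, w x
        ∂(Measure.euclideanHausdorffMeasure (d - 1)) =
      - ∑ h : (T.cell k).halfspaces, h.1.1 i * ∫ x in T.interiorFaceSet ⟨⟨k, h⟩, j⟩, w x
        ∂(Measure.euclideanHausdorffMeasure (d - 1)) := by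
  set S : E d × ℝ → Set (E d) := fun h =>
    {x | inner ℝ h.1 x = h.2} ∩ ((T.cell j).carrier ∩ (T.cell k).carrier ∩ Ω) with hS
  set f : E d × ℝ → ℝ := fun h => h.1 i * ∫ x in S h, w x
        ∂(Measure.euclideanHausdorffMeasure (d - 1)) with hf
  have hSj : ∀ h : (T.cell j).halfspaces, T.interiorFaceSet ⟨⟨j, h⟩, k⟩ = S h.1 := by
    intro h; ext x
    simp only [interiorFaceSet, Polytope.facet, hS, mem_inter_iff, mem_ofPred_eq]; tauto
  have hSk : ∀ h : (T.cell k).halfspaces, T.interiorFaceSet ⟨⟨k, h⟩, j⟩ = S h.1 := by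
    intro h; ext x
    simp only [interiorFaceSet, Polytope.facet, hS, mem_inter_iff, mem_ofPred_eq]; tauto
  have hneg : ∀ h, f (-h) = - f h := by
    intro h
    have : S (-h) = S h := by
      ext x; simp [hS, inner_neg_left]
    simp only [hf, this, Prod.fst_neg, PiLp.neg_apply, neg_mul]
  have hpos : ∀ h, f h ≠ 0 → Measure.euclideanHausdorffMeasure (d - 1) (S h) ≠ 0 := by
    intro h hfh h0
    exact hfh (by simp [hf, Measure.restrict_eq_zero.2 h0])
  have hj : ∀ h ∈ (T.cell j).halfspaces, f h ≠ 0 → -h ∈ (T.cell k).halfspaces := by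
    intro h hh hfh
    refine Polytope.neg_mem_halfspaces (T.disjoint j k hjk) hh fun h0 => hpos h hfh
      (measure_mono_null ?_ h0)
    exact fun x hx => ⟨⟨hx.2.1.1, hx.1⟩, hx.2.1.2⟩
  have hk : ∀ h ∈ (T.cell k).halfspaces, f h ≠ 0 → -h ∈ (T.cell j).halfspaces := by
    intro h hh hfh
    refine Polytope.neg_mem_halfspaces (T.disjoint k j hjk.symm) hh fun h0 => hpos h hfh
      (measure_mono_null ?_ h0)
    exact fun x hx => ⟨⟨hx.2.1.2, hx.1⟩, hx.2.1.1⟩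
  simp_rw [hSj, hSk]
  change ∑ h : (T.cell j).halfspaces, f h.1 = - ∑ h : (T.cell k).halfspaces, f h.1
  rw [Finset.sum_coe_sort, Finset.sum_coe_sort, ← Finset.sum_neg_distrib]
  refine Finset.sum_bij_ne_zero (fun h _ _ => -h) hj (fun _ _ _ _ _ _ h0 => neg_injective h0)
    (fun h hh hfh => ?_) (fun h _ _ => by rw [hneg, neg_neg])
  have hfh' : f h ≠ 0 := by simpa using hfh
  exact ⟨-h, hk h hh hfh', by rw [hneg]; simpa using hfh', neg_neg h⟩

/-- A sum over the interior faces is a sum over all candidates `(K, facet of K, K')` with `K` of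
smaller label, if candidates of measure zero contribute zero. -/
theorem sum_interiorFace (f : (Σ j : Fin T.numCells, (T.cell j).halfspaces) × Fin T.numCells → ℝ)
    (hf : ∀ a, Measure.euclideanHausdorffMeasure (d - 1) (T.interiorFaceSet a) = 0 → f a = 0) :
    ∑ e : T.InteriorFace, f e.1 =
      ∑ j, ∑ k, if j < k then ∑ h : (T.cell j).halfspaces, f ⟨⟨j, h⟩, k⟩ else 0 := by
  classical
  have h1 : ∑ e : T.InteriorFace, f e.1 = ∑ a with (a.1.1 < a.2 ∧
      Measure.euclideanHausdorffMeasure (d - 1) (T.interiorFaceSet a) ≠ 0), f a := by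
    exact (Finset.sum_subtype (p := fun a => a.1.1 < a.2 ∧
      Measure.euclideanHausdorffMeasure (d - 1) (T.interiorFaceSet a) ≠ 0)
      (F := inferInstanceAs (Fintype T.InteriorFace)) _ (fun a => Finset.mem_filter_univ a) f).symm
  have h2 : ∀ a, (if a.1.1 < a.2 ∧
      Measure.euclideanHausdorffMeasure (d - 1) (T.interiorFaceSet a) ≠ 0 then f a else 0) =
      if a.1.1 < a.2 then f a else 0 := by
    intro a
    by_cases h0 : Measure.euclideanHausdorffMeasure (d - 1) (T.interiorFaceSet a) = 0
    · simp [hf a h0]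
    · simp [h0]
  rw [h1, Finset.sum_filter, Finset.sum_congr rfl fun a _ => h2 a, Fintype.sum_prod_type,
    Fintype.sum_sigma]
  refine Finset.sum_congr rfl fun j _ => ?_
  rw [Finset.sum_comm]
  refine Finset.sum_congr rfl fun k _ => ?_
  dsimp only
  split_ifs <;> simp

theorem sum_boundaryFace (f : (Σ j : Fin T.numCells, (T.cell j).halfspaces) → ℝ)
    (hf : ∀ b, Measure.euclideanHausdorffMeasure (d - 1) (T.boundaryFaceSet b) = 0 → f b = 0) :
    ∑ e : T.BoundaryFace, f e.1 = ∑ j, ∑ h : (T.cell j).halfspaces, f ⟨j, h⟩ := by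
  classical
  have h1 : ∑ e : T.BoundaryFace, f e.1 = ∑ b with
      Measure.euclideanHausdorffMeasure (d - 1) (T.boundaryFaceSet b) ≠ 0, f b := by
    exact (Finset.sum_subtype (p := fun b =>
      Measure.euclideanHausdorffMeasure (d - 1) (T.boundaryFaceSet b) ≠ 0)
      (F := inferInstanceAs (Fintype T.BoundaryFace)) _ (fun a => Finset.mem_filter_univ a) f).symm
  rw [h1, Finset.sum_filter_of_ne (p := fun b =>
    Measure.euclideanHausdorffMeasure (d - 1) (T.boundaryFaceSet b) ≠ 0)
    fun b _ hb h0 => hb (hf b h0), Fintype.sum_sigma]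

theorem integrableOn_interiorFaceSet
    (a : (Σ j : Fin T.numCells, (T.cell j).halfspaces) × Fin T.numCells) {f : E d → ℝ}
    (hf : Continuous f) :
    IntegrableOn f (T.interiorFaceSet a) (Measure.euclideanHausdorffMeasure (d - 1)) :=
  integrableOn_facet (fun _ hx => hx.1.1) hf

/-- Summing surface integrals over the boundaries of all elements, face by face: an interior face
contributes the jump, since it is counted with opposite normals from its two sides. -/
theorem sum_facet_integral (hΩ : IsOpen Ω) (i : Fin d) {w : Fin T.numCells → E d → ℝ}
    (hw : ∀ j, Continuous (w j)) :
    ∑ j, ∑ h : (T.cell j).halfspaces, h.1.1 i *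
        ∫ x in (T.cell j).facet h, w j x ∂(Measure.euclideanHausdorffMeasure (d - 1)) =
      (∑ e : T.InteriorFace, e.integral fun x => (w e.left x - w e.right x) * e.normal i) +
        ∑ e : T.BoundaryFace, e.integral fun x => w e.owner x * e.normal i := by
  classical
  set A : Fin T.numCells → Fin T.numCells → (E d → ℝ) → ℝ := fun j k f =>
    ∑ h : (T.cell j).halfspaces, h.1.1 i * ∫ x in T.interiorFaceSet ⟨⟨j, h⟩, k⟩, f x
        ∂(Measure.euclideanHausdorffMeasure (d - 1)) with hA
  have hI : ∑ e : T.InteriorFace, e.integral (fun x => (w e.left x - w e.right x) * e.normal i) =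
      ∑ j, ∑ k, if j < k then A j k (w j) - A j k (w k) else 0 := by
    have := T.sum_interiorFace (fun a => ∫ x in T.interiorFaceSet a,
      (w a.1.1 x - w a.2 x) * a.1.2.1.1 i ∂(Measure.euclideanHausdorffMeasure (d - 1)))
      (fun a h0 => by simp [Measure.restrict_eq_zero.2 h0])
    refine this.trans (Finset.sum_congr rfl fun j _ => Finset.sum_congr rfl fun k _ => ?_)
    refine if_congr Iff.rfl ?_ rfl
    rw [hA, ← Finset.sum_sub_distrib]
    refine Finset.sum_congr rfl fun h _ => ?_
    rw [integral_mul_const, integral_sub (T.integrableOn_interiorFaceSet _ (hw j))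
      (T.integrableOn_interiorFaceSet _ (hw k))]
    ring
  have hB : ∑ e : T.BoundaryFace, e.integral (fun x => w e.owner x * e.normal i) =
      ∑ j, ∑ h : (T.cell j).halfspaces, h.1.1 i * ∫ x in T.boundaryFaceSet ⟨j, h⟩, w j x
        ∂(Measure.euclideanHausdorffMeasure (d - 1)) := by
    have := T.sum_boundaryFace (fun b => ∫ x in T.boundaryFaceSet b,
      w b.1 x * b.2.1.1 i ∂(Measure.euclideanHausdorffMeasure (d - 1)))
      (fun a h0 => by simp [Measure.restrict_eq_zero.2 h0])
    refine this.trans (Finset.sum_congr rfl fun j _ => Finset.sum_congr rfl fun h _ => ?_)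
    rw [integral_mul_const, mul_comm]
  have hL : ∀ j, ∑ h : (T.cell j).halfspaces, h.1.1 i *
        ∫ x in (T.cell j).facet h, w j x ∂(Measure.euclideanHausdorffMeasure (d - 1)) =
      (∑ h : (T.cell j).halfspaces, h.1.1 i * ∫ x in T.boundaryFaceSet ⟨j, h⟩, w j x
        ∂(Measure.euclideanHausdorffMeasure (d - 1))) +
      ∑ k, if k = j then 0 else A j k (w j) := by
    intro j
    simp_rw [T.facet_integral_eq hΩ j _ (hw j), mul_add, Finset.sum_add_distrib, Finset.mul_sum]
    congr 1
    rw [Finset.sum_comm]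
    refine Finset.sum_congr rfl fun k _ => ?_
    split_ifs <;> simp [hA]
  have hsplit : ∀ j k, (if k = j then 0 else A j k (w j)) =
      (if j < k then A j k (w j) else 0) + if k < j then A j k (w j) else 0 := by
    intro j k
    rcases lt_trichotomy j k with h | h | h
    · simp [h, h.ne', h.not_gt]
    · simp [h]
    · simp [h, h.ne, h.not_gt]
  rw [hI, hB, Finset.sum_congr rfl fun j _ => hL j, Finset.sum_add_distrib, add_comm]
  congr 1
  simp_rw [hsplit, Finset.sum_add_distrib]
  rw [Finset.sum_comm (f := fun j k => if k < j then A j k (w j) else 0),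
    ← Finset.sum_add_distrib]
  refine Finset.sum_congr rfl fun j _ => ?_
  rw [← Finset.sum_add_distrib]
  refine Finset.sum_congr rfl fun k _ => ?_
  split_ifs with h
  · rw [sub_eq_add_neg]
    congr 1
    exact T.sum_interiorFaceSet_swap i h.ne' (w k)
  · simp

/-- Distinct interior faces overlap in a null set, since otherwise three elements or two facets of
one element would meet in positive measure. -/
theorem interiorFaceSet_inter_null {e e' : T.InteriorFace} (hne : e ≠ e') :
    Measure.euclideanHausdorffMeasure (d - 1)
      (T.interiorFaceSet e.1 ∩ T.interiorFaceSet e'.1) = 0 := by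
  obtain ⟨⟨⟨j, h⟩, k⟩, hjk, he⟩ := e
  obtain ⟨⟨⟨j', h'⟩, k'⟩, hjk', he'⟩ := e'
  simp only at hjk hjk'
  -- a third element that contains the intersection
  have key : ∀ l, l ≠ j → l ≠ k → T.interiorFaceSet ⟨⟨j', h'⟩, k'⟩ ⊆ (T.cell l).carrier →
      Measure.euclideanHausdorffMeasure (d - 1)
        (T.interiorFaceSet ⟨⟨j, h⟩, k⟩ ∩ T.interiorFaceSet ⟨⟨j', h'⟩, k'⟩) = 0 := by
    intro l hlj hlk hsub
    refine measure_mono_null (fun x hx => ?_) (Polytope.facet_inter_inter_null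
      (T.disjoint j k hjk.ne) (T.disjoint j l hlj.symm) (T.disjoint k l hlk.symm) h)
    exact ⟨hx.1.1, hsub hx.2⟩
  by_cases hj : j' = j
  · subst hj
    by_cases hk : k' = k
    · subst hk
      by_cases hh : h = h'
      · subst hh; exact absurd rfl hne
      · refine measure_mono_null (fun x hx => ?_) ((T.cell j').facet_inter_facet_null hh)
        exact ⟨hx.1.1.1, hx.2.1.1⟩
    · exact key k' hjk'.ne' hk fun x hx => hx.1.2
  · by_cases hk : j' = k
    · subst hk
      exact key k' (hjk.trans hjk').ne' hjk'.ne' fun x hx => hx.1.2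
    · exact key j' hj hk fun x hx => hx.1.1.1

end Mesh

/-! ### Jumps of weakly differentiable functions -/

/-- Restriction of a weak derivative to a smaller open set, together with a change of `v` outside of
it: here `F` is a continuous extension of `v`. -/
theorem IsWeakPartial.restrict {U V : Set (E d)} (hV : IsOpen V) (hVU : V ⊆ U)
    {i : Fin d} {v F g : E d → ℝ} (h : IsWeakPartial U i v g) (hvF : EqOn v F V)
    (hF : Continuous F) : IsWeakPartial V i F g := by
  refine ⟨hF.locallyIntegrable.locallyIntegrableOn _, h.2.1.mono_set hVU, fun φ h1 h2 h3 => ?_⟩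
  have h4 := h.2.2 φ h1 h2 (h3.trans hVU)
  have h0 : ∀ x, x ∉ V → fderiv ℝ φ x = 0 :=
    fun x hx => fderiv_of_notMem_tsupport ℝ fun hx' => hx (h3 hx')
  have h0' : ∀ x, x ∉ V → φ x = 0 := fun x hx => image_eq_zero_of_notMem_tsupport
    fun hx' => hx (h3 hx')
  have h5 : ∫ x in V, F x * fderiv ℝ φ x (EuclideanSpace.single i 1) =
      ∫ x in V, v x * fderiv ℝ φ x (EuclideanSpace.single i 1) :=
    setIntegral_congr_fun hV.measurableSet fun x hx => by simp only [hvF hx]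
  rw [h5, setIntegral_eq_integral_of_forall_compl_eq_zero fun x hx => by simp [h0 x hx],
    setIntegral_eq_integral_of_forall_compl_eq_zero fun x hx => by simp [h0' x hx],
    ← setIntegral_eq_integral_of_forall_compl_eq_zero (s := U)
      fun x hx => by simp [h0 x (fun hx' => hx (hVU hx'))], h4,
    setIntegral_eq_integral_of_forall_compl_eq_zero
      fun x hx => by simp [h0' x (fun hx' => hx (hVU hx'))]]

namespace Mesh

variable {Ω : Set (E d)} (T : Mesh Ω)

/-- Elementwise integration by parts, summed over the mesh. -/
theorem sum_integral_weakPartial (hΩ : IsOpen Ω) {i : Fin d} {v g : E d → ℝ}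
    (hg : IntegrableOn g Ω) (hvg : IsWeakPartial Ω i v g) {F : Fin T.numCells → E d → ℝ}
    (hF : ∀ j, Continuous (F j)) (hvF : ∀ j, EqOn v (F j) (interior (T.cell j).carrier))
    {ψ : Fin T.numCells → E d → ℝ} (hψ : ∀ j, ContDiff ℝ ∞ (ψ j)) :
    ∑ j, ∫ x in interior (T.cell j).carrier,
        (g x * ψ j x + F j x * fderiv ℝ (ψ j) x (EuclideanSpace.single i 1)) =
      (∑ e : T.InteriorFace, e.integral fun x =>
        (F e.left x * ψ e.left x - F e.right x * ψ e.right x) * e.normal i) +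
      ∑ e : T.BoundaryFace, e.integral fun x => F e.owner x * ψ e.owner x * e.normal i := by
  rw [← T.sum_facet_integral hΩ i (w := fun j x => F j x * ψ j x)
    fun j => (hF j).mul (hψ j).continuous]
  exact Finset.sum_congr rfl fun j _ => (T.cell j).integral_weakPartial_mul_add (hF j)
    (hg.mono_set (T.interior_subset j))
    (hvg.restrict isOpen_interior (T.interior_subset j) (hvF j) (hF j)) (hψ j)

theorem setIntegral_eq_sum_interior {f : E d → ℝ} (hf : IntegrableOn f Ω) :
    ∫ x in Ω, f x = ∑ j, ∫ x in interior (T.cell j).carrier, f x := by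
  have h1 : (⋃ j, interior (T.cell j).carrier : Set (E d)) =ᵐ[volume] Ω := by
    refine Filter.EventuallyLE.antisymm
      (Filter.Eventually.of_forall (iUnion_subset T.interior_subset)) (ae_le_set.2 ?_)
    refine measure_mono_null (t := ⋃ j, (T.cell j).carrier \ interior (T.cell j).carrier) ?_
      (measure_iUnion_null fun j => (T.cell j).volume_carrier_diff_interior)
    rintro x ⟨hx, hx'⟩
    have h2 : x ∈ ⋃ j, (T.cell j).carrier := by rw [T.iUnion_eq]; exact subset_closure hx
    obtain ⟨j, hj⟩ := mem_iUnion.1 h2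
    exact mem_iUnion.2 ⟨j, hj, fun h3 => hx' (mem_iUnion.2 ⟨j, h3⟩)⟩
  rw [← setIntegral_congr_set h1, integral_iUnion_fintype
    (fun j => isOpen_interior.measurableSet) (fun j k hjk => T.disjoint j k hjk)
    fun j => hf.mono_set (T.interior_subset j)]

/-- The jumps of `v` are the singular part of its distributional derivative in `Ω`. This part
vanishes, as the derivative is a function. -/
theorem integral_interiorFace_jump_eq_zero (hΩ : IsOpen Ω) {i : Fin d} {v g : E d → ℝ}
    (hv : IntegrableOn v Ω) (hg : IntegrableOn g Ω) (hvg : IsWeakPartial Ω i v g)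
    {F : Fin T.numCells → E d → ℝ}
    (hF : ∀ j, Continuous (F j)) (hvF : ∀ j, EqOn v (F j) (interior (T.cell j).carrier))
    {ψ : E d → ℝ} (hψ : ContDiff ℝ ∞ ψ) (hψc : HasCompactSupport ψ) (hψΩ : tsupport ψ ⊆ Ω) :
    ∑ e : T.InteriorFace, e.integral (fun x =>
      ψ x * ((F e.left x - F e.right x) * e.normal i)) = 0 := by
  have h1 := T.sum_integral_weakPartial hΩ hg hvg hF hvF (ψ := fun _ => ψ) fun _ => hψ
  have hψ' : Continuous fun x => fderiv ℝ ψ x (EuclideanSpace.single i 1) :=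
    (hψ.continuous_fderiv (by simp)).clm_apply continuous_const
  have hB : ∀ e : T.BoundaryFace,
      e.integral (fun x => F e.owner x * ψ x * e.normal i) = 0 := by
    intro e
    refine setIntegral_eq_zero_of_forall_eq_zero fun x hx => ?_
    have : ψ x = 0 := image_eq_zero_of_notMem_tsupport fun hx' => by
      have h2 := hx.2
      rw [hΩ.frontier_eq] at h2
      exact h2.2 (hψΩ hx')
    simp [this]
  have hgψ : IntegrableOn (fun x => g x * ψ x) Ω := by
    obtain ⟨C, hC⟩ := hψ.continuous.bounded_above_of_compact_support hψc
    exact Integrable.mul_bdd (c := C) hg hψ.continuous.aestronglyMeasurable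
      (Filter.Eventually.of_forall hC)
  have hvψ : IntegrableOn (fun x => v x * fderiv ℝ ψ x (EuclideanSpace.single i 1)) Ω := by
    obtain ⟨C, hC⟩ := hψ'.bounded_above_of_compact_support (hψc.fderiv_apply (𝕜 := ℝ) _)
    exact Integrable.mul_bdd (c := C) hv hψ'.aestronglyMeasurable
      (Filter.Eventually.of_forall hC)
  have hL : ∑ j, ∫ x in interior (T.cell j).carrier,
      (g x * ψ x + F j x * fderiv ℝ ψ x (EuclideanSpace.single i 1)) = 0 := by
    have h2 : ∀ j, ∫ x in interior (T.cell j).carrier,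
        (g x * ψ x + F j x * fderiv ℝ ψ x (EuclideanSpace.single i 1)) =
        ∫ x in interior (T.cell j).carrier,
          (g x * ψ x + v x * fderiv ℝ ψ x (EuclideanSpace.single i 1)) := fun j =>
      setIntegral_congr_fun isOpen_interior.measurableSet fun x hx => by simp only [hvF j hx]
    have h3 : IntegrableOn (fun x =>
        g x * ψ x + v x * fderiv ℝ ψ x (EuclideanSpace.single i 1)) Ω := hgψ.add hvψ
    rw [Finset.sum_congr rfl fun j _ => h2 j, ← T.setIntegral_eq_sum_interior h3,
      integral_add hgψ hvψ, hvg.2.2 ψ hψ hψc hψΩ, add_neg_cancel]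
  rw [hL, Finset.sum_congr rfl fun e _ => hB e, Finset.sum_const_zero, add_zero] at h1
  rw [h1]
  refine Finset.sum_congr rfl fun e _ => ?_
  refine congrArg _ (funext fun x => ?_)
  ring

/-- A function of class `H¹(Ω)` has no jumps across the interior faces. -/
theorem jump_ae_eq_zero (hΩ : IsOpen Ω) (hΩb : Bornology.IsBounded Ω) {v : E d → ℝ}
    (hv : MemW1 Ω 2 v)
    {F : Fin T.numCells → E d → ℝ}
    (hF : ∀ j, Continuous (F j)) (hvF : ∀ j, EqOn v (F j) (interior (T.cell j).carrier))
    (e : T.InteriorFace) :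
    ∀ᵐ x ∂((Measure.euclideanHausdorffMeasure (d - 1)).restrict (T.interiorFaceSet e.1)),
      F e.left x = F e.right x := by
  classical
  have hfin : IsFiniteMeasure (volume.restrict Ω) := ⟨by
    rw [Measure.restrict_apply_univ]; exact hΩb.measure_lt_top⟩
  -- a coordinate direction transversal to the face `e`
  obtain ⟨i, hi⟩ : ∃ i, e.normal i ≠ 0 := by
    by_contra! hcon
    have h1 : ‖e.normal‖ = 1 := (T.cell e.left).norm_normal _ e.1.1.2.2
    have h2 : e.normal = 0 := by ext i; exact hcon i
    simp [h2] at h1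
  obtain ⟨g, hg, hvg⟩ := hv.2 i
  set μ : Measure (E d) := Measure.euclideanHausdorffMeasure (d - 1) with hμ
  have hm : ∀ e : T.InteriorFace, MeasurableSet (T.interiorFaceSet e.1) := fun e =>
    T.measurableSet_interiorFaceSet hΩ e.1
  set f : T.InteriorFace → E d → ℝ := fun e x => (F e.left x - F e.right x) * e.normal i with hf
  have hfc : ∀ e, Continuous (f e) := fun e => ((hF _).sub (hF _)).mul continuous_const
  set G : E d → ℝ := fun x => ∑ e : T.InteriorFace, (T.interiorFaceSet e.1).indicator (f e) x
  set ν := μ.restrict (⋃ e : T.InteriorFace, T.interiorFaceSet e.1) with hν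
  have hres : ∀ e : T.InteriorFace, ν.restrict (T.interiorFaceSet e.1) =
      μ.restrict (T.interiorFaceSet e.1) := fun e => by
    rw [hν, Measure.restrict_restrict (hm e), inter_eq_left.2]
    exact subset_iUnion (fun e : T.InteriorFace => T.interiorFaceSet e.1) e
  have hind : ∀ (e : T.InteriorFace) {u : E d → ℝ}, Continuous u →
      Integrable ((T.interiorFaceSet e.1).indicator u) ν := by
    intro e u hu
    rw [integrable_indicator_iff (hm e), IntegrableOn, hres]
    exact T.integrableOn_interiorFaceSet e.1 hu
  have hGi : Integrable G ν := integrable_finsetSum _ fun e _ => hind e (hfc e)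
  -- all faces at once: the density of the jumps with respect to the measure on their union vanishes
  have hG0 : ∀ᵐ x ∂ν, x ∈ Ω → G x = 0 := by
    refine hΩ.ae_eq_zero_of_integral_contDiff_smul_eq_zero
      (hGi.locallyIntegrable.locallyIntegrableOn _) fun ψ h1 h2 h3 => ?_
    have h4 : ∀ x, ψ x • G x =
        ∑ e : T.InteriorFace, (T.interiorFaceSet e.1).indicator (fun x => ψ x * f e x) x := by
      intro x
      rw [smul_eq_mul, Finset.mul_sum]
      refine Finset.sum_congr rfl fun e _ => ?_
      by_cases hx : x ∈ T.interiorFaceSet e.1 <;> simp [hx]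
    simp_rw [h4]
    rw [integral_finsetSum _ fun e _ => hind e (u := fun x => ψ x * f e x)
      (h1.continuous.mul (hfc e))]
    simp_rw [integral_indicator (hm _), hres]
    exact T.integral_interiorFace_jump_eq_zero hΩ (hv.1.integrable (by norm_num))
      (hg.integrable (by norm_num)) hvg hF hvF h1 h2 h3
  have h5 : ∀ᵐ x ∂(μ.restrict (T.interiorFaceSet e.1)), x ∈ Ω → G x = 0 := by
    rw [← hres]
    exact ae_restrict_of_ae hG0
  have h6 : ∀ᵐ x ∂(μ.restrict (T.interiorFaceSet e.1)), ∀ e' : T.InteriorFace, e' ≠ e →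
      x ∉ T.interiorFaceSet e'.1 := by
    rw [ae_all_iff]
    intro e'
    by_cases hne : e' = e
    · simp [hne]
    · have h7 := T.interiorFaceSet_inter_null hne
      rw [← Measure.restrict_apply (hm e')] at h7
      filter_upwards [measure_eq_zero_iff_ae_notMem.1 h7] with x hx _ using hx
  filter_upwards [h5, h6, ae_restrict_mem (hm e)] with x h8 h9 h10
  have h11 : G x = f e x := by
    have : G x = (T.interiorFaceSet e.1).indicator (f e) x :=
      Finset.sum_eq_single e (fun e' _ hne => indicator_of_notMem (h9 e' hne) _)
        (fun h => absurd (Finset.mem_univ e) h)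
    rw [this, indicator_of_mem h10]
  have h12 := h8 h10.2
  rw [h11] at h12
  exact sub_eq_zero.1 ((mul_eq_zero.1 h12).resolve_right hi)

end Mesh

/-! ### Piecewise polynomials and the projection -/

theorem polyEval_C (a : ℝ) : (polyEval (MvPolynomial.C a) : E d → ℝ) = fun _ => a := by
  ext; simp [polyEval]

theorem polyEval_add (p q : MvPolynomial (Fin d) ℝ) :
    polyEval (p + q) = fun x => polyEval p x + polyEval q x := by
  ext; simp [polyEval]

theorem polyEval_mul_X (p : MvPolynomial (Fin d) ℝ) (j : Fin d) :
    polyEval (p * MvPolynomial.X j) =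
      fun x => polyEval p x * (EuclideanSpace.proj j : E d →L[ℝ] ℝ) x := by
  ext; simp [polyEval]

theorem contDiff_polyEval (p : MvPolynomial (Fin d) ℝ) : ContDiff ℝ ∞ (polyEval p) := by
  induction p using MvPolynomial.induction_on with
  | C a => rw [polyEval_C]; exact contDiff_const
  | add p q hp hq => rw [polyEval_add]; exact hp.add hq
  | mul_X p j hp =>
    rw [polyEval_mul_X]
    exact hp.mul (EuclideanSpace.proj j : E d →L[ℝ] ℝ).contDiff

theorem fderiv_polyEval (p : MvPolynomial (Fin d) ℝ) (x : E d) (i : Fin d) :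
    fderiv ℝ (polyEval p) x (EuclideanSpace.single i 1) =
      polyEval (MvPolynomial.pderiv i p) x := by
  have hd : ∀ p : MvPolynomial (Fin d) ℝ, DifferentiableAt ℝ (polyEval p) x := fun p =>
    ((contDiff_polyEval p).differentiable (by simp)).differentiableAt
  induction p using MvPolynomial.induction_on with
  | C a =>
    rw [polyEval_C]
    simp [polyEval]
  | add p q hp hq =>
    rw [polyEval_add, fderiv_fun_add (hd p) (hd q), add_apply, hp, hq]
    simp [polyEval]
  | mul_X p j hp =>
    have h := (EuclideanSpace.proj j : E d →L[ℝ] ℝ).hasFDerivAt (x := x)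
    rw [polyEval_mul_X, fderiv_fun_mul (hd p) h.differentiableAt, h.fderiv, add_apply,
      smul_apply, smul_apply, hp]
    by_cases hij : j = i
    · subst hij
      simp [polyEval, mul_comm]
    · simp [polyEval, MvPolynomial.pderiv_X_of_ne hij, hij, mul_comm]

/-- A polynomial that vanishes on a nonempty open set is zero. -/
theorem eq_zero_of_polyEval_eqOn {p : MvPolynomial (Fin d) ℝ} {U : Set (E d)} (hU : IsOpen U)
    (hne : U.Nonempty) (h : ∀ x ∈ U, polyEval p x = 0) : p = 0 := by
  obtain ⟨x₀, hx₀⟩ := hne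
  have h1 : IsOpen ((fun y : Fin d → ℝ => (WithLp.toLp 2 y : E d)) ⁻¹' U) :=
    hU.preimage (PiLp.continuous_toLp 2 _)
  obtain ⟨ε, hε, h2⟩ := Metric.isOpen_iff.1 h1 x₀.ofLp hx₀
  refine MvPolynomial.funext_set (fun i => Metric.ball (x₀.ofLp i) ε)
    (fun i => infinite_of_mem_nhds _ (Metric.ball_mem_nhds _ hε)) fun y hy => ?_
  rw [map_zero]
  rw [← ball_pi _ hε] at hy
  exact h _ (h2 hy)

theorem Polytope.trace_eq (K : Polytope d) {v F : E d → ℝ} (hF : Continuous F)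
    (hvF : EqOn v F (interior K.carrier)) {x : E d} (hx : x ∈ K.carrier) : K.trace v x = F x := by
  have : (𝓝[interior K.carrier] x).NeBot := by
    rw [← mem_closure_iff_nhdsWithin_neBot, K.closure_interior]
    exact hx
  refine Filter.Tendsto.limUnder_eq ?_
  refine ((hF.tendsto x).mono_left nhdsWithin_le_nhds).congr' ?_
  filter_upwards [self_mem_nhdsWithin] with y hy using (hvF hy).symm

namespace Mesh

variable {Ω : Set (E d)} (T : Mesh Ω)

theorem toFun_eq {r : ℕ} (φ : DGSpace d T.numCells r) {j : Fin T.numCells} {x : E d}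
    (hx : x ∈ interior (T.cell j).carrier) : T.toFun φ x = polyEval (φ j).1 x := by
  unfold Mesh.toFun
  rw [Finset.sum_eq_single j, indicator_of_mem hx]
  · intro k _ hkj
    exact indicator_of_notMem (fun hk => disjoint_left.1 (T.disjoint k j hkj) hk hx) _
  · exact fun h => absurd (Finset.mem_univ j) h

theorem inner_toLp_toL2 {r : ℕ} {g : E d → ℝ} (hg : MemLp g 2 (volume.restrict Ω))
    (φ : DGSpace d T.numCells r) :
    inner ℝ (hg.toLp g) (T.toL2 r φ) =
      ∑ j, ∫ x in interior (T.cell j).carrier, g x * polyEval (φ j).1 x := by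
  have h1 : inner ℝ (hg.toLp g) (T.toL2 r φ) = ∫ x in Ω, g x * T.toFun φ x := by
    rw [L2.inner_def]
    refine integral_congr_ae ?_
    filter_upwards [hg.coeFn_toLp, (T.memLp_toFun φ).coeFn_toLp] with x h1 h2
    have h3 : (T.toL2 r φ : E d → ℝ) x = T.toFun φ x := h2
    rw [h1, h3]
    simp [mul_comm]
  have h2 : IntegrableOn (fun x => g x * T.toFun φ x) Ω := hg.integrable_mul (T.memLp_toFun φ)
  rw [h1, T.setIntegral_eq_sum_interior h2]
  exact Finset.sum_congr rfl fun j _ => setIntegral_congr_fun isOpen_interior.measurableSet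
    fun x hx => by simp only [T.toFun_eq φ hx]

theorem innerProd_eq {r : ℕ} (w φ : DGSpace d T.numCells r) :
    T.innerProd w φ = inner ℝ (T.toL2 r w) (T.toL2 r φ) := by
  have h := T.inner_toLp_toL2 (T.memLp_toFun w) φ
  refine Eq.trans ?_ h.symm
  unfold innerProd
  refine Finset.sum_congr rfl fun j _ => ?_
  rw [Polytope.restrict_carrier_eq]
  exact setIntegral_congr_fun isOpen_interior.measurableSet
    fun x hx => by simp only [T.toFun_eq w hx]

theorem toL2_injective (r : ℕ) : Function.Injective (T.toL2 r) := by
  rw [injective_iff_map_eq_zero]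
  intro w hw
  have h1 : T.toFun w =ᵐ[volume.restrict Ω] 0 := by
    have h2 : (T.toL2 r w : E d → ℝ) =ᵐ[volume.restrict Ω] T.toFun w :=
      (T.memLp_toFun w).coeFn_toLp
    rw [hw] at h2
    exact h2.symm.trans (Lp.coeFn_zero _ _ _)
  funext j
  refine Subtype.ext (eq_zero_of_polyEval_eqOn isOpen_interior (T.cell j).interior_nonempty ?_)
  refine Measure.eqOn_open_of_ae_eq (μ := volume) (g := fun _ => 0) ?_ isOpen_interior
    (continuous_polyEval _).continuousOn continuousOn_const
  filter_upwards [ae_restrict_of_ae_restrict_of_subset (T.interior_subset j) h1,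
    ae_restrict_mem isOpen_interior.measurableSet] with x hx hxj
  rwa [T.toFun_eq w hxj] at hx

/-- If a functional on `V_r^h` is the `L²` pairing with `G`, its Riesz representative exists, is
unique, and is the `L²` projection of `G`. -/
theorem existsUnique_innerProd_eq {r : ℕ} (G : Lp ℝ 2 (volume.restrict Ω))
    {D : DGSpace d T.numCells r → ℝ} (hD : ∀ φ, D φ = inner ℝ G (T.toL2 r φ)) :
    (∃! w : DGSpace d T.numCells r, ∀ φ, T.innerProd w φ = D φ) ∧
      ∀ w : DGSpace d T.numCells r, (∀ φ, T.innerProd w φ = D φ) →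
        T.toL2 r w = T.projection r G := by
  have h2 : ∀ w : DGSpace d T.numCells r, (∀ φ, T.innerProd w φ = D φ) →
      T.toL2 r w = T.projection r G := by
    intro w hw
    refine (Submodule.eq_starProjection_of_mem_of_inner_eq_zero (K := T.dgSubspace r)
      (LinearMap.mem_range_self _ w) ?_).symm
    rintro _ ⟨φ, rfl⟩
    rw [inner_sub_left, ← hD, ← hw, innerProd_eq, sub_self]
  refine ⟨?_, h2⟩
  obtain ⟨w, hw⟩ : T.projection r G ∈ T.dgSubspace r := Submodule.starProjection_apply_mem _ _
  refine ⟨w, fun φ => ?_, fun w' hw' => T.toL2_injective r ((h2 w' hw').trans hw.symm)⟩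
  rw [innerProd_eq, hw, hD]
  have h3 := Submodule.starProjection_inner_eq_zero (K := T.dgSubspace r) G (T.toL2 r φ)
    (LinearMap.mem_range_self _ φ)
  rw [inner_sub_left, sub_eq_zero] at h3
  exact h3.symm

/-- For `v ∈ H¹(Ω)` the right-hand side of the definition of the discrete derivatives is the `L²`
pairing with the weak derivative, whichever one-sided traces and penalties are used. -/
theorem derivForm_eq (hΩ : IsOpen Ω) (hΩb : Bornology.IsBounded Ω) {r : ℕ} {i : Fin d}
    {Q : T.InteriorFace → (E d → ℝ) → E d → ℝ} (γ : T.InteriorFace → ℝ) {v : E d → ℝ}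
    (hv : T.MemBroken v) (hH1 : MemW1 Ω 2 v) {g : E d → ℝ}
    (hg : MemLp g 2 (volume.restrict Ω)) (hgv : IsWeakPartial Ω i v g)
    (hQ : ∀ e x, Q e v x = e.traceLeft v x ∨ Q e v x = e.traceRight v x)
    (φ : DGSpace d T.numCells r) :
    T.derivForm i Q γ v φ = inner ℝ (hg.toLp g) (T.toL2 r φ) := by
  have hfin : IsFiniteMeasure (volume.restrict Ω) := ⟨by
    rw [Measure.restrict_apply_univ]; exact hΩb.measure_lt_top⟩
  have hex : ∀ j, ∃ F : E d → ℝ, Continuous F ∧ EqOn v F (interior (T.cell j).carrier) := by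
    intro j
    obtain ⟨f, hf, hvf⟩ := (hv j).2
    obtain ⟨F, hF⟩ := ContinuousMap.exists_restrict_eq (T.cell j).isClosed_carrier
      ⟨_, hf.domRestrict⟩
    refine ⟨F, F.continuous, fun x hx => ?_⟩
    rw [hvf hx]
    exact (DFunLike.congr_fun hF ⟨x, _root_.interior_subset hx⟩).symm
  -- globally continuous extensions of the restrictions of `v` to the elements
  choose F hF hvF using hex
  have hgi : IntegrableOn g Ω := hg.integrable (by norm_num)
  have hl : ∀ (e : T.InteriorFace) x, x ∈ T.interiorFaceSet e.1 →
      e.traceLeft v x = F e.left x := fun e x hx =>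
    (T.cell e.left).trace_eq (hF _) (hvF _) hx.1.1.1
  have hr : ∀ (e : T.InteriorFace) x, x ∈ T.interiorFaceSet e.1 →
      e.traceRight v x = F e.right x := fun e x hx =>
    (T.cell e.right).trace_eq (hF _) (hvF _) hx.1.2
  have hmem : ∀ e : T.InteriorFace,
      ∀ᵐ x ∂((Measure.euclideanHausdorffMeasure (d - 1)).restrict (T.interiorFaceSet e.1)),
        x ∈ T.interiorFaceSet e.1 := fun e =>
    ae_restrict_mem (T.measurableSet_interiorFaceSet hΩ e.1)
  have hjump := T.jump_ae_eq_zero hΩ hΩb hH1 hF hvF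
  have h1 : ∀ e : T.InteriorFace,
      (e.integral fun x => Q e v x * e.normal i * e.polyJump φ x) = e.integral fun x =>
        (F e.left x * polyEval (φ e.left).1 x - F e.right x * polyEval (φ e.right).1 x) *
          e.normal i := by
    intro e
    refine integral_congr_ae ?_
    filter_upwards [hmem e, hjump e] with x hx hx'
    have hQx : Q e v x = F e.left x := by
      rcases hQ e x with h | h
      · rw [h, hl e x hx]
      · rw [h, hr e x hx, hx']
    rw [hQx, InteriorFace.polyJump, ← hx']
    ring
  have h2 : ∀ e : T.BoundaryFace,
      (e.integral fun x => (T.cell e.owner).trace v x * e.normal i * polyEval (φ e.owner).1 x) =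
        e.integral fun x => F e.owner x * polyEval (φ e.owner).1 x * e.normal i := by
    intro e
    have hm : MeasurableSet (T.boundaryFaceSet e.1) :=
      ((T.cell e.1.1).isClosed_facet e.1.2).measurableSet.inter isClosed_frontier.measurableSet
    refine setIntegral_congr_fun hm fun x hx => ?_
    have : (T.cell e.owner).trace v x = F e.owner x :=
      (T.cell e.owner).trace_eq (hF _) (hvF _) hx.1.1
    simp only [this]
    ring
  have h3 : ∀ e : T.InteriorFace,
      (e.integral fun x => γ e * e.jump v x * e.polyJump φ x) = 0 := by
    intro e
    refine integral_eq_zero_of_ae ?_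
    filter_upwards [hmem e, hjump e] with x hx hx'
    simp [InteriorFace.jump, hl e x hx, hr e x hx, hx']
  have h4 : ∀ j, ∫ x in (T.cell j).carrier, v x * polyEval (MvPolynomial.pderiv i (φ j).1) x =
      ∫ x in interior (T.cell j).carrier, F j x *
        fderiv ℝ (polyEval (φ j).1) x (EuclideanSpace.single i 1) := by
    intro j
    rw [Polytope.restrict_carrier_eq]
    refine setIntegral_congr_fun isOpen_interior.measurableSet fun x hx => ?_
    simp only [hvF j hx, fderiv_polyEval]
  have h5 := T.sum_integral_weakPartial hΩ hgi hgv hF hvF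
    (ψ := fun j => polyEval (φ j).1) fun j => contDiff_polyEval _
  have h6 : ∀ j, ∫ x in interior (T.cell j).carrier, (g x * polyEval (φ j).1 x + F j x *
        fderiv ℝ (polyEval (φ j).1) x (EuclideanSpace.single i 1)) =
      (∫ x in interior (T.cell j).carrier, g x * polyEval (φ j).1 x) +
        ∫ x in interior (T.cell j).carrier, F j x *
          fderiv ℝ (polyEval (φ j).1) x (EuclideanSpace.single i 1) := fun j =>
    integral_add ((T.cell j).integrableOn_interior_mul (hgi.mono_set (T.interior_subset j))
      (continuous_polyEval _)) ((T.cell j).integrableOn_interior ((hF j).mul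
      (((contDiff_polyEval _).continuous_fderiv (by simp)).clm_apply continuous_const)))
  rw [Finset.sum_congr rfl fun j _ => h6 j, Finset.sum_add_distrib] at h5
  rw [T.inner_toLp_toL2 hg φ]
  unfold derivForm
  rw [Finset.sum_congr rfl fun e _ => h1 e, Finset.sum_congr rfl fun e _ => h2 e,
    Finset.sum_congr rfl fun j _ => h4 j, Finset.sum_congr rfl fun e _ => h3 e,
    Finset.sum_const_zero, add_zero, ← h5]
  ring

end Mesh

end DGCalculus

end

theorem mainTheorem5 {d : ℕ} {Ω : Set (DGCalculus.E d)} (hΩ : IsOpen Ω)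
    (hΩb : Bornology.IsBounded Ω) (T : DGCalculus.Mesh Ω) (r : ℕ) (i : Fin d)
    (γm γp : T.InteriorFace → ℝ) (v : DGCalculus.E d → ℝ) (hv : T.MemBroken v)
    (hH1 : DGCalculus.MemW1 Ω 2 v) (g : DGCalculus.E d → ℝ)
    (hg : MemLp g 2 (volume.restrict Ω)) (hgv : DGCalculus.IsWeakPartial Ω i v g) :
    (∃! w : DGCalculus.DGSpace d T.numCells r, T.IsPartialMinus i γm v w) ∧
    (∃! w : DGCalculus.DGSpace d T.numCells r, T.IsPartialPlus i γp v w) ∧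
    T.toL2 r (T.partialMinus r i γm v) = T.projection r (hg.toLp g) ∧
    T.toL2 r (T.partialPlus r i γp v) = T.projection r (hg.toLp g) ∧
    T.toL2 r (T.partialCentral r i γm γp v) = T.projection r (hg.toLp g) := by
  obtain ⟨hm, hm'⟩ := T.existsUnique_innerProd_eq (hg.toLp g)
    (T.derivForm_eq (r := r) (Q := DGCalculus.Mesh.InteriorFace.Qminus i)
      hΩ hΩb γm hv hH1 hg hgv fun e x => by
        unfold DGCalculus.Mesh.InteriorFace.Qminus
        split_ifs
        · exact Or.inl rfl
        · exact Or.inr rfl)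
  obtain ⟨hp, hp'⟩ := T.existsUnique_innerProd_eq (hg.toLp g)
    (T.derivForm_eq (r := r) (Q := DGCalculus.Mesh.InteriorFace.Qplus i)
      hΩ hΩb γp hv hH1 hg hgv fun e x => by
        unfold DGCalculus.Mesh.InteriorFace.Qplus
        split_ifs
        · exact Or.inr rfl
        · exact Or.inl rfl)
  have hM : T.toL2 r (T.partialMinus r i γm v) = T.projection r (hg.toLp g) :=
    hm' _ (Classical.epsilon_spec hm.exists)
  have hP : T.toL2 r (T.partialPlus r i γp v) = T.projection r (hg.toLp g) :=
    hp' _ (Classical.epsilon_spec hp.exists)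
  refine ⟨hm, hp, hM, hP, ?_⟩
  rw [DGCalculus.Mesh.partialCentral, map_smul, map_add, hM, hP, ← two_smul ℝ, smul_smul]
  norm_num
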